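/- Let $n\ge 1$ and let $(\mathcal C,\mathbb E,\mathfrak s)$ be an $n$-exangulated category (in the sense of Herschend–Liu–Nakaoka) with enough projectives $\mathcal P$ and enough injectives $\mathcal I$. That is, every object $C$ occurs as the last term of a distinguished $n$-exangle $B\to P_1\to\cdots\to P_n\to C\dashrightarrow$ with all $P_i\in\mathcal P$, and every object $A$ occurs as the first term of a distinguished $n$-exangle $A\to I_1\to\cdots\to I_n\to B\dashrightarrow$ with all $I_i\in\mathcal I$. Let $S(\mathcal C)$ be the category of distinguished $n$-exangles $\delta=(A_0\xrightarrow{\alpha_0}A_1\to\cdots\xrightarrow{\alpha_n}A_{n+1}\overset{\rho}{\dashrightarrow})$ and their morphisms $(\varphi_0,\dots,\varphi_{n+1})$. Let $\mathcal R_2$ be the ideal of those morphisms $\varphi$ from $(A_\bullet,\alpha_\bullet,\rho)$ to $(B_\bullet,\beta_\bullet,\rho')$ for which $\varphi_{n+1}$ factors through $\beta_n$. Put $$\delta^*=\operatorname{Coker}\bigl(\mathcal C(-,A_n)\to\mathcal C(-,A_{n+1})\bigr),\qquad \delta_*=\operatorname{Coker}\bigl(\mathcal C(A_1,-)\to\mathcal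 C(A_0,-)\bigr)$$ (the contravariant and the covariant defect). For $\mathcal X=\mathcal P$ or $\mathcal X=\mathcal I$ let $\mathcal C/[\mathcal X]$ be the quotient of $\mathcal C$ by the ideal of morphisms factoring through an object of $\mathcal X$. For an additive category $\mathcal D$ let $\mathrm{mod}\text{-}\mathcal D$ be the category of finitely presented additive functors $\mathcal D^{op}\to\mathrm{Ab}$. Modules over $\mathcal C/[\mathcal X]$ are identified with functors on $\mathcal C$ via the projection $\mathcal C\to\mathcal C/[\mathcal X]$. (1) There are equivalences $$S(\mathcal C)/\mathcal R_2\;\cong\;\mathrm{mod}\text{-}(\mathcal C/[\mathcal P])\;\cong\;\bigl(\mathrm{mod}\text{-}(\mathcal C/[\mathcal I])^{op}\bigr)^{op},$$ where the equivalence $S(\mathcal C)/\mathcal R_2\cong\mathrm{mod}\text{-}(\mathcal C/[\mathcal P])$ is given, naturally in $\delta$, by $\delta\mapsto\delta^*$, and the equivalence $S(\mathcal C)/\mathcal R_2\cong(\mathrm{mod}\text{-}(\mathcal C/[\mathcal I])^{op})^{op}$ is given, naturally in $\delta$, by $\delta\mapsto\delta_*$. (2) The category $\mathrm{mod}\text{-}(\mathcal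 C/[\mathcal P])$ is abelian and has enough projectives and enough injectives. Its projective objects are exactly the direct summands of the modules $(\mathcal C/[\mathcal P])(-,A)$, $A\in\mathcal C$; if idempotents split in $\mathcal C/[\mathcal P]$, they are exactly the modules isomorphic to some $(\mathcal C/[\mathcal P])(-,A)$. If $n$ is even, then each $\mathbb E(-,A)$, $A\in\mathcal C$, is an injective object of $\mathrm{mod}\text{-}(\mathcal C/[\mathcal P])$, and the injective objects are exactly the direct summands of the modules $\mathbb E(-,A)$; if moreover idempotents split in $\mathcal C/[\mathcal I]$, they are exactly the modules isomorphic to some $\mathbb E(-,A)$. (3) The category $\mathrm{mod}\text{-}(\mathcal C/[\mathcal I])^{op}$ is abelian and has enough projectives and enough injectives. Its projective objects are exactly the direct summands of the modules $(\mathcal C/[\mathcal I])(A,-)$, $A\in\mathcal C$; if idempotents split in $\mathcal C/[\mathcal I]$, they are exactly the modules isomorphic to some $(\mathcal C/[\mathcal I])(A,-)$. If $n$ is even, then each $\mathbb E(A,-)$, $A\in\mathcal C$, is an injective object of $\mathrm{mod}\text{-}(\mathcal C/[\mathcal I])^{op}$, and the injective objects are exactly the direct summands of the modules $\mathbb E(A,-)$;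 if moreover idempotents split in $\mathcal C/[\mathcal P]$, they are exactly the modules isomorphic to some $\mathbb E(A,-)$. -/

import Mathlib

open CategoryTheory CategoryTheory.Limits Opposite

universe v u

namespace NExang

/-! ### Ideal quotients of additive categories and finitely presented modules -/

section Modules

variable {D : Type u} [Category.{v} D] [Preadditive D]

/-- A class of objects which contains a zero object and is closed under finite direct sums. -/
class IsSumClosed [HasBinaryBiproducts D] (W : ObjectProperty D) : Prop where
  zero : ∃ Z : D, IsZero Z ∧ W Z
  sum : ∀ X Y : D, W X → W Y → W (X ⊞ Y)

/-- Two parallel morphisms are related if their difference factors through an object of `W`. -/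
def idealRel (W : ObjectProperty D) : HomRel D :=
  fun X Y f g => ∃ (Q : D) (_ : W Q) (a : X ⟶ Q) (b : Q ⟶ Y), f - g = a ≫ b

variable [HasBinaryBiproducts D] (W : ObjectProperty D)

lemma idealRel_add [IsSumClosed W] {X Y : D} {f₁ f₂ g₁ g₂ : X ⟶ Y}
    (h₁ : idealRel W f₁ f₂) (h₂ : idealRel W g₁ g₂) : idealRel W (f₁ + g₁) (f₂ + g₂) := by
  obtain ⟨Q, hQ, a, b, h⟩ := h₁
  obtain ⟨Q', hQ', a', b', h'⟩ := h₂
  refine ⟨Q ⊞ Q', IsSumClosed.sum _ _ hQ hQ', biprod.lift a a', biprod.desc b b', ?_⟩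
  rw [biprod.lift_desc, ← h, ← h']
  abel

instance [IsSumClosed W] : Congruence (idealRel W) where
  comp_left := by
    rintro X Y Z f g g' ⟨Q, hQ, a, b, h⟩
    exact ⟨Q, hQ, f ≫ a, b, by rw [← Preadditive.comp_sub, h, Category.assoc]⟩
  comp_right := by
    rintro X Y Z f f' g ⟨Q, hQ, a, b, h⟩
    exact ⟨Q, hQ, a, b ≫ g, by rw [← Preadditive.sub_comp, h, Category.assoc]⟩
  equivalence := by
    intro X Y
    have hrefl : ∀ f : X ⟶ Y, idealRel W f f := fun f => by
      obtain ⟨Z, _, hZ⟩ := IsSumClosed.zero (W := W)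
      exact ⟨Z, hZ, 0, 0, by simp⟩
    have hsymm : ∀ {f g : X ⟶ Y}, idealRel W f g → idealRel W g f := by
      rintro f g ⟨Q, hQ, a, b, h⟩
      exact ⟨Q, hQ, -a, b, by rw [Preadditive.neg_comp, ← h, neg_sub]⟩
    refine ⟨hrefl, hsymm, ?_⟩
    intro f g h h₁ h₂
    obtain ⟨Q, hQ, a, b, e⟩ := idealRel_add W h₁ h₂
    refine ⟨Q, hQ, a, b, ?_⟩
    rw [← e]
    abel

/-- The quotient `D/[W]` of `D` by the ideal of morphisms factoring through an object of `W`. -/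
abbrev IdealQuotient := CategoryTheory.Quotient (idealRel W)

instance [IsSumClosed W] : Preadditive (IdealQuotient W) :=
  CategoryTheory.Quotient.preadditive (idealRel W) (fun _ _ _ _ _ _ h₁ h₂ => idealRel_add W h₁ h₂)

/-- The projection `D ⥤ D/[W]`. -/
abbrev idealProj : D ⥤ IdealQuotient W := CategoryTheory.Quotient.functor (idealRel W)

end Modules

section FinitelyPresented

variable (D : Type u) [Category.{v} D] [Preadditive D]

/-- A right `D`-module is an additive functor `Dᵒᵖ ⥤ Ab`; it is finitely presented if there is an
exact sequence `D(-,X) ⟶ D(-,Y) ⟶ F ⟶ 0`. -/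
def isFinPres : ObjectProperty (Dᵒᵖ ⥤ AddCommGrpCat.{v}) :=
  fun F => F.Additive ∧
    ∃ (X Y : D) (f : X ⟶ Y), Nonempty (cokernel (preadditiveYoneda.map f) ≅ F)

/-- The category `mod-D` of finitely presented right `D`-modules. -/
abbrev FPMod := (isFinPres D).FullSubcategory

variable {D}

lemma isFinPres_yoneda (A : D) : isFinPres D (preadditiveYoneda.obj A) := by
  have h : preadditiveYoneda.map (0 : A ⟶ A) = 0 := by
    ext X f
    exact comp_zero (f := f)
  exact ⟨inferInstance, A, A, 0, ⟨cokernelIsoOfEq h ≪≫ cokernelZeroIsoTarget⟩⟩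

/-- The representable right module `D(-,A)`, as an object of `mod-D`. -/
def FPMod.repr (A : D) : FPMod D := ⟨preadditiveYoneda.obj A, isFinPres_yoneda A⟩

end FinitelyPresented

section Restriction

variable {C : Type u} [Category.{v} C] [Preadditive C] [HasBinaryBiproducts C]
  (W : ObjectProperty C) [IsSumClosed W]

/-- A `C/[W]`-module viewed as a right `C`-module along the projection `C ⥤ C/[W]`. This functor
is fully faithful. -/
def restrict : FPMod (IdealQuotient W) ⥤ (Cᵒᵖ ⥤ AddCommGrpCat.{v}) :=
  (isFinPres (IdealQuotient W)).ι ⋙ (Functor.whiskeringLeft _ _ _).obj (idealProj W).op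

/-- A right `(C/[W])ᵒᵖ`-module, i.e. a covariant functor on `C/[W]`, viewed as a covariant functor
on `C` along the projection `C ⥤ C/[W]`. This functor is fully faithful. -/
def restrictOp : FPMod (IdealQuotient W)ᵒᵖ ⥤ (C ⥤ AddCommGrpCat.{v}) :=
  (isFinPres (IdealQuotient W)ᵒᵖ).ι ⋙
    (Functor.whiskeringLeft _ _ _).obj (idealProj W ⋙ opOp (IdealQuotient W))

end Restriction

/-! ### Complexes with `n + 2` terms and extensions -/

section Complexes

variable {C : Type u} [Category.{v} C] [Preadditive C]

/-- A complex `A = X₀ ⟶ X₁ ⟶ ⋯ ⟶ Xₙ ⟶ Xₙ₊₁ = Z` (zero outside the degrees `0, …, n + 1`) with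
prescribed end terms, where the end terms are identified with `A` and `Z` by isomorphisms that are
part of the data. -/
structure Cpx (n : ℕ) (A Z : C) where
  K : CochainComplex C ℕ
  isZero : ∀ i, n + 1 < i → IsZero (K.X i)
  fst : K.X 0 ≅ A
  lst : K.X (n + 1) ≅ Z

variable {n : ℕ}

/-- The first differential `A ⟶ X₁`. -/
def Cpx.dFirst {A Z : C} (X : Cpx n A Z) : A ⟶ X.K.X 1 := X.fst.inv ≫ X.K.d 0 1

/-- The last differential `Xₙ ⟶ Z`. -/
def Cpx.dLast {A Z : C} (X : Cpx n A Z) : X.K.X n ⟶ Z := X.K.d n (n + 1) ≫ X.lst.hom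

/-- The morphism of complexes `f` is `(a, f₁, …, fₙ, c)`. -/
structure IsLift {A Z A' Z' : C} (X : Cpx n A Z) (Y : Cpx n A' Z') (a : A ⟶ A') (c : Z ⟶ Z')
    (f : X.K ⟶ Y.K) : Prop where
  fst : f.f 0 ≫ Y.fst.hom = X.fst.hom ≫ a
  lst : f.f (n + 1) ≫ Y.lst.hom = X.lst.hom ≫ c

/-- Homotopy equivalence of complexes with fixed end terms `A`, `Z`: both morphisms are the
identity on the end terms. -/
def HEquiv {A Z : C} (X Y : Cpx n A Z) : Prop :=
  ∃ (f : X.K ⟶ Y.K) (g : Y.K ⟶ X.K), IsLift X Y (𝟙 A) (𝟙 Z) f ∧ IsLift Y X (𝟙 A) (𝟙 Z) g ∧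
    Nonempty (Homotopy (f ≫ g) (𝟙 X.K)) ∧ Nonempty (Homotopy (g ≫ f) (𝟙 Y.K))

lemma IsLift.comp {A Z : C} {X Y V : Cpx n A Z} {f : X.K ⟶ Y.K} {g : Y.K ⟶ V.K}
    (hf : IsLift X Y (𝟙 A) (𝟙 Z) f) (hg : IsLift Y V (𝟙 A) (𝟙 Z) g) :
    IsLift X V (𝟙 A) (𝟙 Z) (f ≫ g) where
  fst := by rw [HomologicalComplex.comp_f, Category.assoc, hg.fst, Category.comp_id, hf.fst]
  lst := by rw [HomologicalComplex.comp_f, Category.assoc, hg.lst, Category.comp_id, hf.lst]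

/-- Homotopy equivalence with fixed end terms, as a setoid. -/
def heSetoid (n : ℕ) (A Z : C) : Setoid (Cpx n A Z) where
  r := HEquiv
  iseqv :=
    { refl := fun X => ⟨𝟙 _, 𝟙 _, ⟨by simp, by simp⟩, ⟨by simp, by simp⟩,
        ⟨Homotopy.ofEq (by simp)⟩, ⟨Homotopy.ofEq (by simp)⟩⟩
      symm := fun ⟨f, g, hf, hg, h, h'⟩ => ⟨g, f, hg, hf, h', h⟩
      trans := by
        rintro X Y V ⟨f, g, hf, hg, ⟨h⟩, ⟨h'⟩⟩ ⟨f', g', hf', hg', ⟨k⟩, ⟨k'⟩⟩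
        refine ⟨f ≫ f', g' ≫ g, hf.comp hf', hg'.comp hg, ⟨?_⟩, ⟨?_⟩⟩
        · exact (Homotopy.ofEq (by simp)).trans
            ((((k.compLeft f).compRight g).trans (Homotopy.ofEq (by simp))).trans h)
        · exact (Homotopy.ofEq (by simp)).trans
            ((((h'.compLeft g').compRight f').trans (Homotopy.ofEq (by simp))).trans k') }

variable (E : Cᵒᵖ ⥤ C ⥤ AddCommGrpCat.{v})

/-- The group `𝔼(Z, A)` of extensions. -/
abbrev Ext (Z A : C) := (E.obj (op Z)).obj A

/-- `δ ↦ a_* δ`. -/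
def push {Z A A' : C} (a : A ⟶ A') : Ext E Z A →+ Ext E Z A' := ((E.obj (op Z)).map a).hom

/-- `δ ↦ c^* δ`. -/
def pull {Z Z' A : C} (c : Z' ⟶ Z) : Ext E Z A →+ Ext E Z' A := ((E.map c.op).app A).hom

/-- The pair `⟨X, δ⟩` is an `n`-exangle: it is an `𝔼`-attached complex, and the sequences
`C(-,X₀) ⟶ ⋯ ⟶ C(-,Xₙ₊₁) ⟶ 𝔼(-,X₀)` and `C(Xₙ₊₁,-) ⟶ ⋯ ⟶ C(X₀,-) ⟶ 𝔼(Xₙ₊₁,-)` are exact. -/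
structure IsExangle {A Z : C} (X : Cpx n A Z) (δ : Ext E Z A) : Prop where
  push_dFirst : push E X.dFirst δ = 0
  pull_dLast : pull E X.dLast δ = 0
  contra : ∀ i, i < n → ∀ (T : C) (f : T ⟶ X.K.X (i + 1)), f ≫ X.K.d (i + 1) (i + 2) = 0 →
    ∃ g : T ⟶ X.K.X i, g ≫ X.K.d i (i + 1) = f
  contra_last : ∀ (T : C) (f : T ⟶ Z), pull E f δ = 0 → ∃ g : T ⟶ X.K.X n, g ≫ X.dLast = f
  co : ∀ i, i < n → ∀ (T : C) (f : X.K.X (i + 1) ⟶ T), X.K.d i (i + 1) ≫ f = 0 →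
    ∃ g : X.K.X (i + 2) ⟶ T, X.K.d (i + 1) (i + 2) ≫ g = f
  co_first : ∀ (T : C) (f : A ⟶ T), push E f δ = 0 → ∃ g : X.K.X 1 ⟶ T, X.dFirst ≫ g = f

end Complexes

/-! ### Mapping cones and cocones -/

section Cones

variable {C : Type u} [Category.{v} C] [Preadditive C] [HasBinaryBiproducts C]

/-- A mapping cone of `f : X ⟶ Y` (with `f₀` an identity): a complex
`X₁ ⟶ X₂ ⊞ Y₁ ⟶ ⋯ ⟶ Xₙ₊₁ ⊞ Yₙ ⟶ Yₙ₊₁` with differentials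
`(-d, f₁)`, `((-d, 0), (fᵢ₊₁, d))`, `(fₙ₊₁, d)`. Its terms are presented through their projections
`p i : Mᵢ ⟶ Xᵢ₊₁` (for `i ≤ n`) and `q i : Mᵢ₊₁ ⟶ Yᵢ₊₁` (for `i ≤ n`); the values of `p` and `q` at
`i > n` play no role. -/
structure MappingCone (n : ℕ) {X Y : CochainComplex C ℕ} (f : X ⟶ Y) where
  M : CochainComplex C ℕ
  isZero : ∀ i, n + 1 < i → IsZero (M.X i)
  p : ∀ i, M.X i ⟶ X.X (i + 1)
  q : ∀ i, M.X (i + 1) ⟶ Y.X (i + 1)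
  iso_first : IsIso (p 0)
  iso_mid : ∀ i, i < n → IsIso (biprod.lift (p (i + 1)) (q i))
  iso_last : IsIso (q n)
  d_p : ∀ i, i < n → M.d i (i + 1) ≫ p (i + 1) = -(p i ≫ X.d (i + 1) (i + 2))
  d_q_zero : M.d 0 1 ≫ q 0 = p 0 ≫ f.f 1
  d_q_succ : ∀ i, i < n → M.d (i + 1) (i + 2) ≫ q (i + 1) =
    p (i + 1) ≫ f.f (i + 2) + q i ≫ Y.d (i + 1) (i + 2)

/-- The mapping cone as a complex from `X₁` to the last term of `Y`. -/
noncomputable def MappingCone.toCpx {n : ℕ} {A A' Z Z' : C} {X : Cpx n A Z} {Y : Cpx n A' Z'}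
    {f : X.K ⟶ Y.K} (N : MappingCone n f) : Cpx n (X.K.X 1) Z' where
  K := N.M
  isZero := N.isZero
  fst := haveI := N.iso_first; asIso (N.p 0)
  lst := (haveI := N.iso_last; asIso (N.q n)) ≪≫ Y.lst

/-- A mapping cocone of `h : X ⟶ Y` (with `hₙ₊₁` an identity), the exact dual of the mapping cone:
a complex `X₀ ⟶ X₁ ⊞ Y₀ ⟶ ⋯ ⟶ Xₙ ⊞ Yₙ₋₁ ⟶ Yₙ` with differentials
`(d, h₀)`, `((d, 0), (hᵢ, -d))`, `(hₙ, -d)`. Its terms are presented through their projections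
`p i : Mᵢ ⟶ Xᵢ` (for `i ≤ n`) and `q i : Mᵢ₊₁ ⟶ Yᵢ` (for `i ≤ n`); the values of `p` and `q` at
`i > n` play no role. -/
structure MappingCocone (n : ℕ) {X Y : CochainComplex C ℕ} (h : X ⟶ Y) where
  M : CochainComplex C ℕ
  isZero : ∀ i, n + 1 < i → IsZero (M.X i)
  p : ∀ i, M.X i ⟶ X.X i
  q : ∀ i, M.X (i + 1) ⟶ Y.X i
  iso_first : IsIso (p 0)
  iso_mid : ∀ i, i < n → IsIso (biprod.lift (p (i + 1)) (q i))
  iso_last : IsIso (q n)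
  d_p : ∀ i, i < n → M.d i (i + 1) ≫ p (i + 1) = p i ≫ X.d i (i + 1)
  d_q_zero : M.d 0 1 ≫ q 0 = p 0 ≫ h.f 0
  d_q_succ : ∀ i, i < n → M.d (i + 1) (i + 2) ≫ q (i + 1) =
    p (i + 1) ≫ h.f (i + 1) - q i ≫ Y.d i (i + 1)

/-- The mapping cocone as a complex from the first term of `X` to `Yₙ`. -/
noncomputable def MappingCocone.toCpx {n : ℕ} {A A' Z Z' : C} {X : Cpx n A Z} {Y : Cpx n A' Z'}
    {h : X.K ⟶ Y.K} (N : MappingCocone n h) : Cpx n A (Y.K.X n) where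
  K := N.M
  isZero := N.isZero
  fst := (haveI := N.iso_first; asIso (N.p 0)) ≪≫ X.fst
  lst := haveI := N.iso_last; asIso (N.q n)

end Cones

/-! ### `n`-exangulated categories -/

/-- A correspondence which associates to each extension `δ ∈ 𝔼(Z, A)` a homotopy equivalence class
of complexes with end terms `A`, `Z`. -/
abbrev Correspondence (n : ℕ) {C : Type u} [Category.{v} C] [Preadditive C]
    (E : Cᵒᵖ ⥤ C ⥤ AddCommGrpCat.{v}) :=
  ∀ ⦃Z A : C⦄, Ext E Z A → _root_.Quotient (heSetoid n A Z)

section Correspondence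

variable {n : ℕ} {C : Type u} [Category.{v} C] [Preadditive C]
  {E : Cᵒᵖ ⥤ C ⥤ AddCommGrpCat.{v}} (s : Correspondence n E)

/-- `X` realizes `δ`, i.e. `⟨X, δ⟩` is distinguished: `𝔰(δ) = [X]`. -/
def Realizes {A Z : C} (X : Cpx n A Z) (δ : Ext E Z A) : Prop :=
  s δ = _root_.Quotient.mk (heSetoid n A Z) X

/-- `f` is the first differential of a complex realizing some extension. -/
def IsInflation {A B : C} (f : A ⟶ B) : Prop :=
  ∃ (Z : C) (δ : Ext E Z A) (X : Cpx n A Z) (e : X.K.X 1 ≅ B),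
    Realizes s X δ ∧ X.dFirst ≫ e.hom = f

/-- `g` is the last differential of a complex realizing some extension. -/
def IsDeflation {B Z : C} (g : B ⟶ Z) : Prop :=
  ∃ (A : C) (δ : Ext E Z A) (X : Cpx n A Z) (e : B ≅ X.K.X n),
    Realizes s X δ ∧ e.hom ≫ X.dLast = g

end Correspondence

/-- An `n`-exangulated structure `(𝔼, 𝔰)` on the additive category `C`: an additive bifunctor `𝔼`
with an exact realization `𝔰`, satisfying (EA1), (EA2) and the dual of (EA2). -/
structure ExangulatedStructure (n : ℕ) (C : Type u) [Category.{v} C] [Preadditive C]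
    [HasZeroObject C] [HasBinaryBiproducts C] where
  E : Cᵒᵖ ⥤ C ⥤ AddCommGrpCat.{v}
  additive_left : E.Additive
  additive_right : ∀ Z : Cᵒᵖ, (E.obj Z).Additive
  s : Correspondence n E
  /-- (R0) -/
  exists_lift : ∀ {A Z A' Z' : C} (δ : Ext E Z A) (ρ : Ext E Z' A') (X : Cpx n A Z)
    (Y : Cpx n A' Z') (a : A ⟶ A') (c : Z ⟶ Z'), Realizes s X δ → Realizes s Y ρ →
    push E a δ = pull E c ρ → ∃ f : X.K ⟶ Y.K, IsLift X Y a c f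
  /-- (R1) -/
  isExangle : ∀ {A Z : C} (X : Cpx n A Z) (δ : Ext E Z A), Realizes s X δ → IsExangle E X δ
  /-- (R2): `0 ∈ 𝔼(0, A)` is realized by `A = A ⟶ 0 ⟶ ⋯ ⟶ 0` -/
  zero_left : ∀ {A Z : C} (X : Cpx n A Z), IsZero Z → IsIso (X.K.d 0 1) →
    (∀ i, 2 ≤ i → IsZero (X.K.X i)) → Realizes s X (0 : Ext E Z A)
  /-- (R2): `0 ∈ 𝔼(A, 0)` is realized by `0 ⟶ ⋯ ⟶ 0 ⟶ A = A` -/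
  zero_right : ∀ {Z A : C} (X : Cpx n Z A), IsZero Z → IsIso (X.K.d n (n + 1)) →
    (∀ i, i < n → IsZero (X.K.X i)) → Realizes s X (0 : Ext E A Z)
  /-- (EA1) -/
  inflation_comp : ∀ {A B B' : C} (f : A ⟶ B) (g : B ⟶ B'),
    IsInflation s f → IsInflation s g → IsInflation s (f ≫ g)
  /-- (EA1) -/
  deflation_comp : ∀ {A B B' : C} (f : A ⟶ B) (g : B ⟶ B'),
    IsDeflation s f → IsDeflation s g → IsDeflation s (f ≫ g)
  /-- (EA2) -/
  good_lift : ∀ {A Z Z' : C} (ρ : Ext E Z' A) (c : Z ⟶ Z') (X : Cpx n A Z) (Y : Cpx n A Z'),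
    Realizes s X (pull E c ρ) → Realizes s Y ρ →
    ∃ (f : X.K ⟶ Y.K) (_ : IsLift X Y (𝟙 A) c f) (N : MappingCone n f),
      Realizes s N.toCpx (push E X.dFirst ρ)
  /-- the dual of (EA2) -/
  good_lift_op : ∀ {A A' Z : C} (ρ : Ext E Z A) (a : A ⟶ A') (X : Cpx n A Z) (Y : Cpx n A' Z),
    Realizes s X ρ → Realizes s Y (push E a ρ) →
    ∃ (h : X.K ⟶ Y.K) (_ : IsLift X Y a (𝟙 Z) h) (N : MappingCocone n h),
      Realizes s N.toCpx (pull E Y.dLast ρ)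

namespace ExangulatedStructure

variable {n : ℕ} {C : Type u} [Category.{v} C] [Preadditive C] [HasZeroObject C]
  [HasBinaryBiproducts C] (S : ExangulatedStructure n C)

/-- The class of projective objects. -/
def proj : ObjectProperty C := fun P =>
  ∀ ⦃A Z : C⦄ (X : Cpx n A Z) (δ : Ext S.E Z A), Realizes S.s X δ →
    ∀ c : P ⟶ Z, ∃ b : P ⟶ X.K.X n, b ≫ X.dLast = c

/-- The class of injective objects. -/
def inj : ObjectProperty C := fun I =>
  ∀ ⦃A Z : C⦄ (X : Cpx n A Z) (δ : Ext S.E Z A), Realizes S.s X δ →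
    ∀ a : A ⟶ I, ∃ b : X.K.X 1 ⟶ I, X.dFirst ≫ b = a

instance : IsSumClosed S.proj where
  zero := by
    obtain ⟨Z, hZ⟩ := HasZeroObject.zero (C := C)
    exact ⟨Z, hZ, fun _ _ _ _ _ _ => ⟨0, hZ.eq_of_src _ _⟩⟩
  sum P Q hP hQ A Z X δ h c := by
    obtain ⟨b, hb⟩ := hP X δ h (biprod.inl ≫ c)
    obtain ⟨b', hb'⟩ := hQ X δ h (biprod.inr ≫ c)
    exact ⟨biprod.desc b b', by ext <;> simp [hb, hb']⟩

instance : IsSumClosed S.inj where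
  zero := by
    obtain ⟨Z, hZ⟩ := HasZeroObject.zero (C := C)
    exact ⟨Z, hZ, fun _ _ _ _ _ _ => ⟨0, hZ.eq_of_tgt _ _⟩⟩
  sum P Q hP hQ A Z X δ h c := by
    obtain ⟨b, hb⟩ := hP X δ h (c ≫ biprod.fst)
    obtain ⟨b', hb'⟩ := hQ X δ h (c ≫ biprod.snd)
    exact ⟨biprod.lift b b', by ext <;> simp [hb, hb']⟩

/-- Enough projectives: each object `Z` is the last term of a distinguished `n`-exangle
`B ⟶ P₁ ⟶ ⋯ ⟶ Pₙ ⟶ Z` with `P₁, …, Pₙ` projective. -/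
def HasEnoughProj : Prop :=
  ∀ Z : C, ∃ (B : C) (X : Cpx n B Z) (δ : Ext S.E Z B), Realizes S.s X δ ∧
    ∀ i, 1 ≤ i → i ≤ n → S.proj (X.K.X i)

/-- Enough injectives: each object `A` is the first term of a distinguished `n`-exangle
`A ⟶ I₁ ⟶ ⋯ ⟶ Iₙ ⟶ B` with `I₁, …, Iₙ` injective. -/
def HasEnoughInj : Prop :=
  ∀ A : C, ∃ (B : C) (X : Cpx n A B) (δ : Ext S.E B A), Realizes S.s X δ ∧
    ∀ i, 1 ≤ i → i ≤ n → S.inj (X.K.X i)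

/-- The category `C/[P]`. -/
abbrev ModProj := IdealQuotient S.proj

/-- The category `C/[I]`. -/
abbrev ModInj := IdealQuotient S.inj

/-! ### The category of `n`-exangles and the defects -/

/-- A distinguished `n`-exangle, an object of `S(C)`. -/
structure Exangle where
  K : CochainComplex C ℕ
  isZero : ∀ i, n + 1 < i → IsZero (K.X i)
  δ : Ext S.E (K.X (n + 1)) (K.X 0)
  realizes : Realizes S.s ⟨K, isZero, Iso.refl _, Iso.refl _⟩ δ

variable {S}

/-- A morphism of distinguished `n`-exangles. -/
@[ext]
structure Exangle.Hom (X Y : S.Exangle) where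
  hom : X.K ⟶ Y.K
  compat : push S.E (hom.f 0) X.δ = pull S.E (hom.f (n + 1)) Y.δ

instance : Category S.Exangle where
  Hom := Exangle.Hom
  id X := ⟨𝟙 X.K, by simp [push, pull]⟩
  comp {X Y V} f g := ⟨f.hom ≫ g.hom, by
    have h₁ := congrArg (push S.E (g.hom.f 0)) f.compat
    have h₂ := congrArg (pull S.E (f.hom.f (n + 1))) g.compat
    have h₃ : push S.E (g.hom.f 0) (pull S.E (f.hom.f (n + 1)) Y.δ) =
        pull S.E (f.hom.f (n + 1)) (push S.E (g.hom.f 0) Y.δ) :=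
      ConcreteCategory.congr_hom ((S.E.map (f.hom.f (n + 1)).op).naturality (g.hom.f 0)) Y.δ |>.symm
    simp only [push, pull] at h₁ h₂ h₃ ⊢
    simp only [HomologicalComplex.comp_f, Functor.map_comp, op_comp, NatTrans.comp_app,
      AddCommGrpCat.hom_comp, AddMonoidHom.comp_apply]
    rw [h₁, h₃, h₂]⟩

variable (S)

/-- Two parallel morphisms `φ, ψ : X ⟶ Y` of `n`-exangles are related if `φ - ψ` lies in the ideal
`R₂`, i.e. if `φₙ₊₁ - ψₙ₊₁` factors through the last differential `Yₙ ⟶ Yₙ₊₁`. -/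
def relR₂ : HomRel S.Exangle := fun X Y φ ψ =>
  ∃ g : X.K.X (n + 1) ⟶ Y.K.X n, φ.hom.f (n + 1) - ψ.hom.f (n + 1) = g ≫ Y.K.d n (n + 1)

instance : Congruence S.relR₂ where
  comp_left := by
    rintro X Y Z f g g' ⟨a, h⟩
    refine ⟨f.hom.f (n + 1) ≫ a, ?_⟩
    change f.hom.f (n + 1) ≫ g.hom.f (n + 1) - f.hom.f (n + 1) ≫ g'.hom.f (n + 1) = _
    rw [← Preadditive.comp_sub, h, Category.assoc]
  comp_right := by
    rintro X Y Z f f' g ⟨a, h⟩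
    refine ⟨a ≫ g.hom.f n, ?_⟩
    change f.hom.f (n + 1) ≫ g.hom.f (n + 1) - f'.hom.f (n + 1) ≫ g.hom.f (n + 1) = _
    rw [← Preadditive.sub_comp, h, Category.assoc, Category.assoc, g.hom.comm]
  equivalence := by
    intro X Y
    refine ⟨fun f => ⟨0, by simp⟩, ?_, ?_⟩
    · rintro f g ⟨a, h⟩
      exact ⟨-a, by rw [Preadditive.neg_comp, ← h, neg_sub]⟩
    · rintro f g h ⟨a, h₁⟩ ⟨b, h₂⟩
      exact ⟨a + b, by rw [Preadditive.add_comp, ← h₁, ← h₂, sub_add_sub_cancel]⟩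

/-- The quotient category `S(C)/R₂`. -/
abbrev ExangleQuotient := CategoryTheory.Quotient S.relR₂

/-- The projection `S(C) ⥤ S(C)/R₂`. -/
abbrev exangleProj : S.Exangle ⥤ S.ExangleQuotient := CategoryTheory.Quotient.functor S.relR₂

/-- The contravariant defect `δ^* = Coker (C(-,Xₙ) ⟶ C(-,Xₙ₊₁))`, as a functor on `S(C)`. -/
noncomputable def contraDefect : S.Exangle ⥤ (Cᵒᵖ ⥤ AddCommGrpCat.{v}) where
  obj X := cokernel (preadditiveYoneda.map (X.K.d n (n + 1)))
  map {X Y} φ := cokernel.map _ _ (preadditiveYoneda.map (φ.hom.f n))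
    (preadditiveYoneda.map (φ.hom.f (n + 1)))
    (by rw [← Functor.map_comp, ← Functor.map_comp, φ.hom.comm])
  map_id X := by
    apply coequalizer.hom_ext
    change cokernel.π _ ≫ _ = cokernel.π _ ≫ _
    rw [cokernel.π_desc]
    change preadditiveYoneda.map (𝟙 _) ≫ _ = _
    rw [CategoryTheory.Functor.map_id, Category.id_comp, Category.comp_id]
  map_comp {X Y V} φ ψ := by
    apply coequalizer.hom_ext
    change cokernel.π _ ≫ _ = cokernel.π _ ≫ _
    rw [cokernel.π_desc]
    change preadditiveYoneda.map (φ.hom.f (n + 1) ≫ ψ.hom.f (n + 1)) ≫ _ = _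
    simp

/-- The covariant defect `δ_* = Coker (C(X₁,-) ⟶ C(X₀,-))`, as a contravariant functor on
`S(C)`. -/
noncomputable def coDefect : S.Exangle ⥤ (C ⥤ AddCommGrpCat.{v})ᵒᵖ where
  obj X := op (cokernel (preadditiveCoyoneda.map (X.K.d 0 1).op))
  map {X Y} φ := (cokernel.map _ _ (preadditiveCoyoneda.map (φ.hom.f 1).op)
    (preadditiveCoyoneda.map (φ.hom.f 0).op)
    (by rw [← Functor.map_comp, ← Functor.map_comp, ← op_comp, ← op_comp, φ.hom.comm])).op
  map_id X := by
    apply Quiver.Hom.unop_inj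
    apply coequalizer.hom_ext
    change cokernel.π _ ≫ _ = cokernel.π _ ≫ _
    dsimp only [Quiver.Hom.unop_op]
    rw [cokernel.π_desc]
    change preadditiveCoyoneda.map (𝟙 _) ≫ _ = _
    rw [CategoryTheory.Functor.map_id, Category.id_comp]
    exact (Category.comp_id _).symm
  map_comp {X Y V} φ ψ := by
    apply Quiver.Hom.unop_inj
    apply coequalizer.hom_ext
    change cokernel.π _ ≫ _ = cokernel.π _ ≫ _
    dsimp only [Quiver.Hom.unop_op]
    rw [cokernel.π_desc]
    change preadditiveCoyoneda.map (φ.hom.f 0 ≫ ψ.hom.f 0).op ≫ _ = _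
    simp

end ExangulatedStructure

end NExang

-- By (R1), `δ^*` is the image of `C(-,Aₙ₊₁) ⟶ 𝔼(-,A₀)`: a morphism into `Aₙ₊₁` becomes zero in it
-- iff it factors through the last differential `αₙ`, iff it pulls the extension `ρ` back to `0`. A
-- morphism through a projective lifts along every deflation, so the cokernel of `C(-,αₙ)` is the
-- restriction of the cokernel formed over `C/[P]`. Thus the defect is a functor to `mod-(C/[P])`.
--
-- It is an equivalence modulo `R₂` for three reasons. Two morphisms induce the same map of defects
-- iff their last components differ by a morphism through `βₙ`, which is the definition of `R₂`. For
-- fullness, a map of defects lifts to a commutative square on the last differentials; its right leg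
-- `c` satisfies `αₙ^* c^* ρ' = 0`, so exactness of `C(A₀,-) ⟶ 𝔼(Aₙ₊₁,-) ⟶ 𝔼(Aₙ,-)` (`exists_push`,
-- a consequence of the dual of (EA2)) gives `a` with `a_* ρ = c^* ρ'`, and (R0) applies. For
-- density, let `f : X ⟶ Y`, take an exangle with projective middle terms ending in `Y`, and pull
-- its extension back along `f`. By (EA2) a mapping cone is distinguished; its last differential is
-- `(f, p) : X ⊞ Pₙ ⟶ Y`, which has the same cokernel as `f` over `C/[P]` (`lastArrow_presents`).
-- The covariant defect is treated dually. Its kernel is the same ideal because `a_* ρ = c^* ρ'`: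
-- one side vanishes iff `a` factors through `α₀`, the other iff `c` factors through `βₙ`.
--
-- The module categories are abelian because `C/[P]` and `(C/[I])ᵒᵖ` have weak kernels, read off
-- from realizations of `f^* δ` and `f_* δ`. Projectives are described by Yoneda. Injectives come
-- from the duality obtained by composing the two equivalences, which exchanges `δ^*` and `δ_*`: for
-- an exangle `A ⟶ I₁ ⟶ ⋯ ⟶ Z` with injective middle terms, `δ_*` is the representable
-- `(C/[I])(A,-)`, while `δ^*` is `𝔼(-,A)`, by exactness of `C(-,Z) ⟶ 𝔼(-,A) ⟶ 𝔼(-,I₁)`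
-- (`exists_pull`) and `𝔼(-,I₁) = 0`.
--
-- Modules are handled through elements: `IsPres` records a generator and its relations, so that all
-- comparisons of modules reduce to the question which morphisms factor through which.

universe v₁ u₁ v₂ u₂ v₃ u₃

namespace NExang

/-! ### Functors with values in abelian groups, elementwise -/

section Elements

variable {D : Type u} [Category.{v} D]

/-- The restriction along `g` of the elements of a right module. -/
def res (F : Dᵒᵖ ⥤ AddCommGrpCat.{v}) {T Y : D} (g : T ⟶ Y) :
    F.obj (op Y) →+ F.obj (op T) := (F.map g.op).hom

/-- The value of a natural transformation on elements. -/
def ev {F G : Dᵒᵖ ⥤ AddCommGrpCat.{v}} (φ : F ⟶ G) (T : D) :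
    F.obj (op T) →+ G.obj (op T) := (φ.app (op T)).hom

variable {F G H : Dᵒᵖ ⥤ AddCommGrpCat.{v}}

@[simp]
lemma res_id {T : D} (x : F.obj (op T)) : res F (𝟙 T) x = x := by simp [res]

@[simp]
lemma res_comp {S T Y : D} (g : S ⟶ T) (h : T ⟶ Y) (x : F.obj (op Y)) :
    res F (g ≫ h) x = res F g (res F h x) := by simp [res]

lemma ev_res (φ : F ⟶ G) {T Y : D} (g : T ⟶ Y) (x : F.obj (op Y)) :
    ev φ T (res F g x) = res G g (ev φ Y x) :=
  ConcreteCategory.congr_hom (φ.naturality g.op) x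

@[simp]
lemma ev_id {T : D} (x : F.obj (op T)) : ev (𝟙 F) T x = x := rfl

@[simp]
lemma ev_comp (φ : F ⟶ G) (ψ : G ⟶ H) {T : D} (x : F.obj (op T)) :
    ev (φ ≫ ψ) T x = ev ψ T (ev φ T x) := rfl

@[simp]
lemma ev_zero {T : D} (x : F.obj (op T)) : ev (0 : F ⟶ G) T x = 0 := rfl

@[simp]
lemma ev_add (φ ψ : F ⟶ G) {T : D} (x : F.obj (op T)) :
    ev (φ + ψ) T x = ev φ T x + ev ψ T x := rfl

lemma ev_ext {φ ψ : F ⟶ G} (h : ∀ T x, ev φ T x = ev ψ T x) : φ = ψ := by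
  ext T x
  exact h T.unop x

lemma isIso_of_ev (φ : F ⟶ G) (h : ∀ T, Function.Bijective (ev φ T)) : IsIso φ := by
  have : ∀ T, IsIso (φ.app T) := fun T => by
    rw [ConcreteCategory.isIso_iff_bijective]
    exact h T.unop
  exact NatIso.isIso_of_isIso_app φ

lemma ev_surjective (φ : F ⟶ G) [Epi φ] (T : D) : Function.Surjective (ev φ T) :=
  (AddCommGrpCat.epi_iff_surjective (φ.app (op T))).1 inferInstance

lemma epi_of_ev (φ : F ⟶ G) (h : ∀ T, Function.Surjective (ev φ T)) : Epi φ := by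
  rw [NatTrans.epi_iff_epi_app]
  exact fun T => (AddCommGrpCat.epi_iff_surjective _).2 (h T.unop)

lemma ev_injective (φ : F ⟶ G) [Mono φ] (T : D) : Function.Injective (ev φ T) :=
  (AddCommGrpCat.mono_iff_injective (φ.app (op T))).1 inferInstance

lemma ev_exact {S : ShortComplex (Dᵒᵖ ⥤ AddCommGrpCat.{v})} (hS : S.Exact) (T : D)
    (x : S.X₂.obj (op T)) (hx : ev S.g T x = 0) : ∃ w, ev S.f T w = x :=
  (ShortComplex.ab_exact_iff _).1 (hS.map ((evaluation _ _).obj (op T))) x hx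

/-- Stated for an arbitrary cokernel cofork because the closure properties of finitely presented
modules supply one that is not the chosen cokernel. -/
lemma ev_isColimit {φ : F ⟶ G} {k : CokernelCofork φ} (hk : IsColimit k) :
    (∀ T, Function.Surjective (ev k.π T)) ∧
      ∀ T x, ev k.π T x = 0 ↔ ∃ w, ev φ T w = x := by
  have : Epi k.π := epi_of_isColimit_cofork hk
  refine ⟨ev_surjective k.π, fun T x => ⟨fun hx => ?_, ?_⟩⟩
  · exact ev_exact (S := ShortComplex.mk φ k.π k.condition)
      (ShortComplex.exact_of_g_is_cokernel _
        (IsColimit.ofIsoColimit hk (Cofork.ext (Iso.refl _)))) T x hx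
  · rintro ⟨w, rfl⟩
    rw [← ev_comp, k.condition]
    rfl

lemma ev_isLimit {φ : F ⟶ G} {k : KernelFork φ} (hk : IsLimit k) :
    (∀ T, Function.Injective (ev k.ι T)) ∧
      ∀ T x, ev φ T x = 0 ↔ ∃ w, ev k.ι T w = x := by
  have : Mono k.ι := mono_of_isLimit_fork hk
  refine ⟨ev_injective k.ι, fun T x => ⟨fun hx => ?_, ?_⟩⟩
  · exact ev_exact (S := ShortComplex.mk k.ι φ k.condition)
      (ShortComplex.exact_of_f_is_kernel _
        (IsLimit.ofIsoLimit hk (Fork.ext (Iso.refl _)))) T x hx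
  · rintro ⟨w, rfl⟩
    rw [← ev_comp, k.condition]
    rfl

variable [Preadditive D]

lemma res_add [F.Additive] {T Y : D} (g h : T ⟶ Y) (x : F.obj (op Y)) :
    res F (g + h) x = res F g x + res F h x := by
  simp [res]

@[simp]
lemma res_zero [F.Additive] {T Y : D} (x : F.obj (op Y)) : res F (0 : T ⟶ Y) x = 0 := by
  simp [res]

lemma res_sub [F.Additive] {T Y : D} (g h : T ⟶ Y) (x : F.obj (op Y)) :
    res F (g - h) x = res F g x - res F h x := by
  rw [eq_sub_iff_add_eq, ← res_add, sub_add_cancel]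

lemma additive_of_res (h : ∀ {T Y : D} (g h : T ⟶ Y) (x : F.obj (op Y)),
    res F (g + h) x = res F g x + res F h x) : F.Additive where
  map_add {X Y f g} := by
    ext x
    exact h f.unop g.unop x

lemma additive_of_injective (φ : F ⟶ G) [G.Additive] (h : ∀ T, Function.Injective (ev φ T)) :
    F.Additive :=
  additive_of_res fun g g' x => h _ (by simp [ev_res, res_add])

lemma additive_of_surjective (φ : F ⟶ G) [F.Additive] (h : ∀ T, Function.Surjective (ev φ T)) :
    G.Additive :=
  additive_of_res fun g g' x => by
    obtain ⟨w, rfl⟩ := h _ x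
    simp [← ev_res, res_add]

/-- A morphism as an element of a representable module. -/
def toEl {T Y : D} (g : T ⟶ Y) : (preadditiveYoneda.obj Y).obj (op T) := g

/-- An element of a representable module as a morphism. -/
def ofEl {T Y : D} (x : (preadditiveYoneda.obj Y).obj (op T)) : T ⟶ Y := x

lemma toEl_injective {T Y : D} {g h : T ⟶ Y} (e : toEl g = toEl h) : g = h := e

lemma exists_toEl {T Y : D} (x : (preadditiveYoneda.obj Y).obj (op T)) :
    ∃ g : T ⟶ Y, toEl g = x := ⟨ofEl x, rfl⟩

@[simp]
lemma toEl_zero {T Y : D} : toEl (0 : T ⟶ Y) = 0 := rfl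

lemma res_yoneda {S T Y : D} (g : S ⟶ T) (h : T ⟶ Y) :
    res (preadditiveYoneda.obj Y) g (toEl h) = toEl (g ≫ h) := rfl

lemma ev_yoneda {T Y Z : D} (g : Y ⟶ Z) (h : T ⟶ Y) :
    ev (preadditiveYoneda.map g) T (toEl h) = toEl (h ≫ g) := rfl

/-- The map out of a representable module given by an element. -/
def yonedaHom (F : Dᵒᵖ ⥤ AddCommGrpCat.{v}) [F.Additive] {Y : D} (y : F.obj (op Y)) :
    preadditiveYoneda.obj Y ⟶ F where
  app T := AddCommGrpCat.ofHom
    { toFun := fun g => res F (T := T.unop) g y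
      map_zero' := res_zero y
      map_add' := fun g h => res_add g h y }
  naturality S T f := by
    ext g
    exact res_comp f.unop g y

@[simp]
lemma ev_yonedaHom [F.Additive] {T Y : D} (y : F.obj (op Y)) (g : T ⟶ Y) :
    ev (yonedaHom F y) T (toEl g) = res F g y := rfl

lemma ev_yoneda_eq {Y : D} (φ : preadditiveYoneda.obj Y ⟶ F) {T : D} (g : T ⟶ Y) :
    ev φ T (toEl g) = res F g (ev φ Y (toEl (𝟙 Y))) := by
  rw [← ev_res, res_yoneda, Category.comp_id]

lemma yoneda_ext {Y : D} {φ ψ : preadditiveYoneda.obj Y ⟶ F}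
    (h : ev φ Y (toEl (𝟙 Y)) = ev ψ Y (toEl (𝟙 Y))) : φ = ψ := by
  refine ev_ext fun T x => ?_
  obtain ⟨g, rfl⟩ := exists_toEl x
  rw [ev_yoneda_eq φ, ev_yoneda_eq ψ, h]

end Elements

/-! ### Presentations -/

section Presentations

variable {D : Type u} [Category.{v} D]

/-- The element `y` presents `F` as the cokernel of `D(-,X) ⟶ D(-,Y)`. -/
structure IsPres (F : Dᵒᵖ ⥤ AddCommGrpCat.{v}) {X Y : D} (f : X ⟶ Y) (y : F.obj (op Y)) :
    Prop where
  gen : ∀ {T : D} (x : F.obj (op T)), ∃ g : T ⟶ Y, res F g y = x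
  rel : ∀ {T : D} (g : T ⟶ Y), res F g y = 0 ↔ ∃ h, h ≫ f = g

variable {F G : Dᵒᵖ ⥤ AddCommGrpCat.{v}}

lemma IsPres.res_eq_zero {X Y : D} {f : X ⟶ Y} {y : F.obj (op Y)} (h : IsPres F f y) :
    res F f y = 0 := (h.rel f).2 ⟨𝟙 _, Category.id_comp f⟩

lemma IsPres.of_iso {X Y : D} {f : X ⟶ Y} {y : F.obj (op Y)} (h : IsPres F f y) (e : F ≅ G) :
    IsPres G f (ev e.hom Y y) where
  gen {T} x := by
    obtain ⟨g, hg⟩ := h.gen (ev e.inv T x)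
    refine ⟨g, ?_⟩
    rw [← ev_res, hg, ← ev_comp, e.inv_hom_id, ev_id]
  rel {T} g := by
    rw [← h.rel, ← ev_res]
    refine ⟨fun h0 => ?_, fun h0 => by rw [h0, map_zero]⟩
    have := congrArg (ev e.inv T) h0
    rwa [← ev_comp, e.hom_inv_id, ev_id, map_zero] at this

lemma IsPres.hom_ext {X Y : D} {f : X ⟶ Y} {y : F.obj (op Y)} (h : IsPres F f y)
    {φ ψ : F ⟶ G} (e : ev φ Y y = ev ψ Y y) : φ = ψ := ev_ext fun T x => by
  obtain ⟨g, rfl⟩ := h.gen x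
  rw [ev_res, ev_res, e]

lemma IsPres.isIso {X X' Y Y' : D} {f : X ⟶ Y} {y : F.obj (op Y)} (hF : IsPres F f y)
    {f' : X' ⟶ Y'} {y' : G.obj (op Y')} (hG : IsPres G f' y') (φ : F ⟶ G) (c : Y ⟶ Y')
    (hφ : ev φ Y y = res G c y') (hsurj : ∀ {T : D} (g : T ⟶ Y'), ∃ g' : T ⟶ Y,
      res G (g' ≫ c) y' = res G g y') (hinj : ∀ {T : D} (g : T ⟶ Y), res G (g ≫ c) y' = 0 →
        res F g y = 0) : IsIso φ := by
  refine isIso_of_ev φ fun T => ⟨?_, fun x => ?_⟩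
  · rw [injective_iff_map_eq_zero]
    intro x hx
    obtain ⟨g, rfl⟩ := hF.gen x
    rw [ev_res, hφ, ← res_comp] at hx
    exact hinj g hx
  · obtain ⟨g, rfl⟩ := hG.gen x
    obtain ⟨g', hg'⟩ := hsurj g
    exact ⟨res F g' y, by rw [ev_res, hφ, ← res_comp, hg']⟩

variable [Preadditive D]

lemma isPres_cokernel {X Y : D} (f : X ⟶ Y) :
    IsPres (cokernel (preadditiveYoneda.map f)) f
      (ev (cokernel.π (preadditiveYoneda.map f)) Y (toEl (𝟙 Y))) where
  gen {T} x := by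
    obtain ⟨w, rfl⟩ := ev_surjective (cokernel.π (preadditiveYoneda.map f)) T x
    obtain ⟨g, rfl⟩ := exists_toEl w
    exact ⟨g, (ev_yoneda_eq _ g).symm⟩
  rel {T} g := by
    rw [← ev_yoneda_eq]
    refine ((ev_isColimit (cokernelIsCokernel (preadditiveYoneda.map f))).2 T (toEl g)).trans
      ⟨fun ⟨w, hw⟩ => ?_, fun ⟨h, hh⟩ => ⟨toEl h, by rw [ev_yoneda, hh]⟩⟩
    obtain ⟨h, rfl⟩ := exists_toEl w
    exact ⟨h, toEl_injective hw⟩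

/-- A map out of a presented module. -/
lemma IsPres.exists_hom [G.Additive] {X Y : D} {f : X ⟶ Y} {y : F.obj (op Y)} [F.Additive]
    (h : IsPres F f y) (z : G.obj (op Y)) (hz : res G f z = 0) : ∃ φ : F ⟶ G, ev φ Y y = z := by
  have : Epi (yonedaHom F y) := epi_of_ev _ fun T x => by
    obtain ⟨g, hg⟩ := h.gen x
    exact ⟨toEl g, hg⟩
  -- The kernel of `D(-,Y) ⟶ F` consists of the multiples of `f`, and `z` is killed by `f`; hence
  -- the map given by `z` descends to `F`.
  have hk : kernel.ι (yonedaHom F y) ≫ yonedaHom G z = 0 := ev_ext fun T w => by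
    obtain ⟨g, hg⟩ := exists_toEl (ev (kernel.ι (yonedaHom F y)) T w)
    have hw : res F g y = 0 := by
      rw [← ev_yonedaHom, hg, ← ev_comp, kernel.condition, ev_zero]
    obtain ⟨k, rfl⟩ := (h.rel _).1 hw
    rw [ev_comp, ← hg, ev_yonedaHom, res_comp, hz, map_zero, ev_zero]
  obtain ⟨φ, hφ⟩ : ∃ φ, yonedaHom F y ≫ φ = yonedaHom G z :=
    ⟨Abelian.epiDesc _ _ hk, Abelian.comp_epiDesc _ _ hk⟩
  refine ⟨φ, ?_⟩
  have := congrArg (fun t => ev t Y (toEl (𝟙 Y))) hφ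
  simpa using this

lemma IsPres.nonempty_iso [F.Additive] [G.Additive] {X X' Y : D} {f : X ⟶ Y} {f' : X' ⟶ Y}
    {y : F.obj (op Y)} (hF : IsPres F f y) {z : G.obj (op Y)} (hG : IsPres G f' z)
    (h : ∀ {T : D} (g : T ⟶ Y), (∃ k, k ≫ f = g) ↔ ∃ k, k ≫ f' = g) : Nonempty (F ≅ G) := by
  obtain ⟨φ, hφ⟩ := hF.exists_hom z ((hG.rel f).2 ((h f).1 ⟨𝟙 _, Category.id_comp f⟩))
  have := hF.isIso hG φ (𝟙 Y) (by simpa using hφ) (fun g => ⟨g, by simp⟩)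
    (fun g hg => (hF.rel g).2 ((h g).2 ((hG.rel g).1 (by simpa using hg))))
  exact ⟨asIso φ⟩

lemma IsPres.isFinPres [F.Additive] {X Y : D} {f : X ⟶ Y} {y : F.obj (op Y)} (h : IsPres F f y) :
    isFinPres D F := by
  have h' := isPres_cokernel f
  have : (cokernel (preadditiveYoneda.map f)).Additive :=
    additive_of_surjective (cokernel.π (preadditiveYoneda.map f)) (ev_surjective _)
  exact ⟨inferInstance, X, Y, f, h'.nonempty_iso h fun _ => Iff.rfl⟩

lemma exists_isPres (hF : isFinPres D F) :
    ∃ (X Y : D) (f : X ⟶ Y) (y : F.obj (op Y)), IsPres F f y := by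
  obtain ⟨-, X, Y, f, ⟨e⟩⟩ := hF
  exact ⟨X, Y, f, _, (isPres_cokernel f).of_iso e⟩

lemma isPres_yoneda (A : D) : IsPres (preadditiveYoneda.obj A) (0 : A ⟶ A) (toEl (𝟙 A)) where
  gen {T} x := by
    obtain ⟨g, rfl⟩ := exists_toEl x
    exact ⟨g, by rw [res_yoneda, Category.comp_id]⟩
  rel {T} g := by
    rw [res_yoneda, Category.comp_id]
    exact ⟨fun h => ⟨0, by rw [comp_zero]; exact (toEl_injective h).symm⟩,
      fun ⟨k, hk⟩ => by rw [← hk, comp_zero, toEl_zero]⟩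

end Presentations

/-! ### Closure properties of finitely presented modules -/

section Closure

variable (D : Type u) [Category.{v} D] [Preadditive D]

/-- Each morphism has a weak kernel. -/
def WeakKernels : Prop :=
  ∀ ⦃X Y : D⦄ (f : X ⟶ Y), ∃ (K : D) (k : K ⟶ X),
    ∀ ⦃T : D⦄ (g : T ⟶ X), g ≫ f = 0 ↔ ∃ h, h ≫ k = g

variable {D}

/-- A weak pullback is a weak kernel of `(f, -g)` on `X ⊞ Y`. Only its leg to `X` is kept, since
that leg already decides which `t` occur. -/
lemma WeakKernels.pullback [HasBinaryBiproducts D] (hD : WeakKernels D) {X Y Z : D} (f : X ⟶ Z)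
    (g : Y ⟶ Z) : ∃ (K : D) (k : K ⟶ X), ∀ {T : D} (t : T ⟶ X),
      (∃ s : T ⟶ Y, s ≫ g = t ≫ f) ↔ ∃ h, h ≫ k = t := by
  obtain ⟨K, k, hk⟩ := hD (biprod.desc f (-g))
  refine ⟨K, k ≫ biprod.fst, fun {T} t => ⟨fun ⟨s, hs⟩ => ?_, fun ⟨h, hh⟩ => ?_⟩⟩
  · obtain ⟨h, hh⟩ := (hk (biprod.lift t s)).1 (by simp [hs])
    exact ⟨h, by rw [← Category.assoc, hh, biprod.lift_fst]⟩
  · have h0 := (hk (h ≫ k)).2 ⟨h, rfl⟩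
    refine ⟨h ≫ k ≫ biprod.snd, ?_⟩
    rw [← hh]
    rw [biprod.desc_eq] at h0
    simp only [Preadditive.comp_add, Preadditive.comp_neg, Category.assoc] at h0 ⊢
    exact (eq_of_sub_eq_zero (by rw [sub_eq_add_neg]; exact h0)).symm

open ZeroObject in
instance [HasZeroObject D] : (isFinPres D).ContainsZero where
  exists_zero := by
    refine ⟨0, isZero_zero _, ?_⟩
    have h0 : ∀ {T : D} (x : (0 : Dᵒᵖ ⥤ AddCommGrpCat.{v}).obj (op T)), x = 0 := fun {T} x => by
      rw [← ev_id (F := 0) x, (isZero_zero (Dᵒᵖ ⥤ AddCommGrpCat.{v})).eq_of_src (𝟙 _) 0, ev_zero]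
    have : (0 : Dᵒᵖ ⥤ AddCommGrpCat.{v}).Additive :=
      additive_of_res fun _ _ _ => (h0 _).trans (h0 _).symm
    obtain ⟨Z, -⟩ := HasZeroObject.zero (C := D)
    exact IsPres.isFinPres (f := 𝟙 Z) (y := 0)
      ⟨fun x => ⟨0, (h0 _).trans (h0 _).symm⟩, fun g => ⟨fun _ => ⟨g, by simp⟩, fun _ => h0 _⟩⟩

instance : (isFinPres D).IsClosedUnderIsomorphisms where
  of_iso {F G} e hF := by
    have := hF.1
    obtain ⟨X, Y, f, y, hy⟩ := exists_isPres hF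
    have := additive_of_surjective e.hom (ev_surjective _)
    exact (hy.of_iso e).isFinPres

variable [HasBinaryBiproducts D]

/-- The generator of `G` still generates; its relations are the old ones, along `f'`, together with
a lift `c` of the image of the generator of `F`. No weak kernels enter. -/
instance : (isFinPres D).IsClosedUnderCokernels where
  cokernels_le := by
    rintro _ ⟨φ, k, hk, hF, hG⟩
    rename_i F G
    have := hF.1
    have := hG.1
    obtain ⟨X, Y, f, y, hy⟩ := exists_isPres hF
    obtain ⟨X', Y', f', y', hy'⟩ := exists_isPres hG
    obtain ⟨hs, hex⟩ := ev_isColimit hk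
    have := additive_of_surjective k.π hs
    obtain ⟨c, hc⟩ := hy'.gen (ev φ Y y)
    refine IsPres.isFinPres (f := biprod.desc c f') (y := ev k.π Y' y') ⟨fun x => ?_, fun {T} g => ?_⟩
    · obtain ⟨w, rfl⟩ := hs _ x
      obtain ⟨g, rfl⟩ := hy'.gen w
      exact ⟨g, (ev_res _ _ _).symm⟩
    · rw [← ev_res]
      refine (hex T _).trans ⟨fun ⟨w, hw⟩ => ?_, fun ⟨h, hh⟩ => ?_⟩
      · obtain ⟨t, rfl⟩ := hy.gen w
        rw [ev_res, ← hc, ← res_comp, ← sub_eq_zero, ← res_sub] at hw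
        obtain ⟨h, hh⟩ := (hy'.rel _).1 hw
        exact ⟨biprod.lift t (-h), by simp [hh]⟩
      · refine ⟨res F (h ≫ biprod.fst) y, ?_⟩
        rw [ev_res, ← hc, ← res_comp, ← sub_eq_zero, ← res_sub, hy'.rel]
        refine ⟨-(h ≫ biprod.snd), ?_⟩
        rw [← hh, biprod.desc_eq]
        simp

/-- Two weak pullbacks: `q` picks out the elements of `D(-,Y)` that `φ` sends to zero, so it
generates the kernel, and `r` picks out those multiples of `q` that vanish already in `F`, which are
the relations. -/
lemma isClosedUnderKernels (hD : WeakKernels D) : (isFinPres D).IsClosedUnderKernels where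
  kernels_le := by
    rintro _ ⟨φ, k, hk, hF, hG⟩
    rename_i F G
    have := hF.1
    have := hG.1
    obtain ⟨X, Y, f, y, hy⟩ := exists_isPres hF
    obtain ⟨X', Y', f', y', hy'⟩ := exists_isPres hG
    obtain ⟨hi, hex⟩ := ev_isLimit hk
    have := additive_of_injective k.ι hi
    obtain ⟨c, hc⟩ := hy'.gen (ev φ Y y)
    obtain ⟨Q, q, hq⟩ := hD.pullback c f'
    obtain ⟨R, r, hr⟩ := hD.pullback q f
    have hker : ∀ {T : D} (t : T ⟶ Y), ev φ T (res F t y) = 0 ↔ ∃ h, h ≫ q = t := fun {T} t => by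
      rw [← hq, ev_res, ← hc, ← res_comp, hy'.rel]
    obtain ⟨z, hz⟩ := (hex Q (res F q y)).1 ((hker q).2 ⟨𝟙 _, Category.id_comp q⟩)
    refine IsPres.isFinPres (f := r) (y := z) ⟨fun {T} x => ?_, fun {T} g => ?_⟩
    · obtain ⟨t, ht⟩ := hy.gen (ev k.ι T x)
      obtain ⟨h, rfl⟩ := (hker t).1 (by rw [ht]; exact (hex T _).2 ⟨x, rfl⟩)
      exact ⟨h, hi T (by rw [ev_res, hz, ← res_comp, ht])⟩
    · rw [← hr, ← hy.rel, res_comp, ← hz, ← ev_res]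
      exact ⟨fun h => by rw [h, map_zero], fun h => hi T (by rw [h, map_zero])⟩

instance : (isFinPres D).IsClosedUnderBinaryProducts where
  limitsOfShape_le := by
    rintro K ⟨p⟩
    have hF := p.prop_diag_obj (.mk .left)
    have hG := p.prop_diag_obj (.mk .right)
    set F := p.diag.obj (.mk .left)
    set G := p.diag.obj (.mk .right)
    -- Closure is demanded for every limit cone over every diagram of this shape; it is reduced to
    -- the biproduct of the two values.
    have e : F ⊞ G ≅ K := IsLimit.conePointUniqueUpToIso (BinaryBiproduct.isLimit F G)
      ((IsLimit.postcomposeHomEquiv (diagramIsoPair p.diag) _).2 p.isLimit)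
    refine (isFinPres D).prop_of_iso e ?_
    have := hF.1
    have := hG.1
    obtain ⟨X, Y, f, y, hy⟩ := exists_isPres hF
    obtain ⟨X', Y', f', y', hy'⟩ := exists_isPres hG
    have hext : ∀ {T : D} {x x' : (F ⊞ G).obj (op T)},
        ev (biprod.fst : F ⊞ G ⟶ F) T x = ev biprod.fst T x' →
        ev (biprod.snd : F ⊞ G ⟶ G) T x = ev biprod.snd T x' → x = x' := fun {T x x'} h h' => by
      rw [← ev_id x, ← ev_id x', ← biprod.total, ev_add, ev_add, ev_comp, ev_comp, ev_comp,
        ev_comp, h, h']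
    have : (F ⊞ G).Additive := additive_of_res fun g g' x =>
      hext (by simp [ev_res, res_add]) (by simp [ev_res, res_add])
    let w : (F ⊞ G).obj (op (Y ⊞ Y')) := ev (biprod.inl : F ⟶ F ⊞ G) _ (res F biprod.fst y) +
      ev (biprod.inr : G ⟶ F ⊞ G) _ (res G biprod.snd y')
    have h₁ : ev (biprod.fst : F ⊞ G ⟶ F) _ w = res F biprod.fst y := by
      simp only [w, map_add, ← ev_comp, biprod.inl_fst, biprod.inr_fst, ev_id, ev_zero, add_zero]
    have h₂ : ev (biprod.snd : F ⊞ G ⟶ G) _ w = res G biprod.snd y' := by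
      simp only [w, map_add, ← ev_comp, biprod.inl_snd, biprod.inr_snd, ev_id, ev_zero, zero_add]
    refine IsPres.isFinPres (f := biprod.map f f') (y := w) ⟨fun {T} x => ?_, fun {T} g => ?_⟩
    · obtain ⟨g, hg⟩ := hy.gen (ev (biprod.fst : F ⊞ G ⟶ F) T x)
      obtain ⟨g', hg'⟩ := hy'.gen (ev (biprod.snd : F ⊞ G ⟶ G) T x)
      refine ⟨biprod.lift g g', hext ?_ ?_⟩
      · rw [ev_res, h₁, ← res_comp, biprod.lift_fst, hg]
      · rw [ev_res, h₂, ← res_comp, biprod.lift_snd, hg']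
    · have hg : res (F ⊞ G) g w = 0 ↔ res F (g ≫ biprod.fst) y = 0 ∧
          res G (g ≫ biprod.snd) y' = 0 := by
        rw [res_comp, res_comp, ← h₁, ← h₂, ← ev_res, ← ev_res]
        exact ⟨fun h => by rw [h, map_zero, map_zero]; exact ⟨rfl, rfl⟩,
          fun h => hext (by rw [h.1, map_zero]) (by rw [h.2, map_zero])⟩
      rw [hg, hy.rel, hy'.rel]
      constructor
      · rintro ⟨⟨h, hh⟩, ⟨h', hh'⟩⟩
        exact ⟨biprod.lift h h', by ext <;> simp [hh, hh']⟩
      · rintro ⟨h, rfl⟩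
        exact ⟨⟨h ≫ biprod.fst, by simp⟩, ⟨h ≫ biprod.snd, by simp⟩⟩

instance [HasZeroObject D] : (isFinPres D).IsClosedUnderFiniteProducts := .mk'

end Closure

/-! ### The abelian category of finitely presented modules -/

section Abelian

variable {D : Type u} [Category.{v} D] [Preadditive D] [HasBinaryBiproducts D]

/-- Kernels, cokernels and finite products of the ambient functor category stay inside. The equation
says that the additive structure is the inherited one. -/
lemma exists_abelian [HasZeroObject D] (hD : WeakKernels D) :
    ∃ a : Abelian (FPMod D), a.toPreadditive = Preadditive.fullSubcategory _ := by
  have := isClosedUnderKernels hD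
  exact ⟨inferInstance, rfl⟩

/-- The element corresponding to a morphism out of a representable module. -/
def evOne {M : FPMod D} {Y : D} (φ : FPMod.repr Y ⟶ M) : M.obj.obj (op Y) :=
  ev (F := preadditiveYoneda.obj Y) φ.hom Y (toEl (𝟙 Y))

omit [HasBinaryBiproducts D] in
lemma evOne_comp {M N : FPMod D} {Y : D} (φ : FPMod.repr Y ⟶ M) (ψ : M ⟶ N) :
    evOne (φ ≫ ψ) = ev ψ.hom Y (evOne φ) := rfl

omit [HasBinaryBiproducts D] in
lemma evOne_injective {M : FPMod D} {Y : D} {φ ψ : FPMod.repr Y ⟶ M} (h : evOne φ = evOne ψ) :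
    φ = ψ := ObjectProperty.hom_ext _ (yoneda_ext h)

omit [HasBinaryBiproducts D] in
lemma exists_evOne {M : FPMod D} {Y : D} (y : M.obj.obj (op Y)) :
    ∃ φ : FPMod.repr Y ⟶ M, evOne φ = y := by
  have := M.property.1
  exact ⟨ObjectProperty.homMk (yonedaHom M.obj y), (ev_yonedaHom _ _).trans (res_id y)⟩

omit [HasBinaryBiproducts D] in
lemma exists_ev_eq_res {M : FPMod D} {T Y : D} (φ : FPMod.repr Y ⟶ M) (g : T ⟶ Y) :
    ∃ x, ev φ.hom T x = res M.obj g (evOne φ) := ⟨toEl g, ev_yoneda_eq (F := M.obj) φ.hom g⟩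

/-- An epimorphism of `mod-D` is surjective on elements because its cokernel in the functor category
is again finitely presented, so that it can be tested inside `mod-D`. -/
lemma FPMod.ev_surjective {M N : FPMod D} (φ : M ⟶ N) [Epi φ] (T : D) :
    Function.Surjective (ev φ.hom T) := by
  let c : N ⟶ ⟨cokernel φ.hom, (isFinPres D).prop_cokernel φ.hom M.property N.property⟩ :=
    ObjectProperty.homMk (cokernel.π φ.hom)
  have hc : c = 0 := by
    rw [← cancel_epi φ, comp_zero]
    exact ObjectProperty.hom_ext _ (cokernel.condition φ.hom)
  have : Epi φ.hom := Preadditive.epi_of_cokernel_zero (congrArg (·.hom) hc)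
  exact NExang.ev_surjective φ.hom T

omit [HasBinaryBiproducts D] in
lemma FPMod.epi_of_ev {M N : FPMod D} (φ : M ⟶ N)
    (h : ∀ T, Function.Surjective (ev φ.hom T)) : Epi φ := by
  have := NExang.epi_of_ev φ.hom h
  exact (isFinPres D).ι.epi_of_epi_map this

lemma projective_repr (A : D) : Projective (FPMod.repr A) where
  factors {N X} f e _ := by
    obtain ⟨x, hx⟩ := FPMod.ev_surjective e A (evOne f)
    obtain ⟨φ, rfl⟩ := exists_evOne x
    exact ⟨φ, evOne_injective (by rw [evOne_comp, hx])⟩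

omit [HasBinaryBiproducts D] in
lemma exists_epi_repr (M : FPMod D) : ∃ (Y : D) (φ : FPMod.repr Y ⟶ M), Epi φ := by
  obtain ⟨X, Y, f, y, hy⟩ := exists_isPres M.property
  obtain ⟨φ, rfl⟩ := exists_evOne y
  refine ⟨Y, φ, FPMod.epi_of_ev φ fun T x => ?_⟩
  obtain ⟨g, rfl⟩ := hy.gen x
  exact exists_ev_eq_res φ g

lemma enoughProjectives : EnoughProjectives (FPMod D) where
  presentation M := by
    obtain ⟨Y, φ, hφ⟩ := exists_epi_repr M
    exact ⟨{ p := FPMod.repr Y, projective := projective_repr Y, f := φ, epi := hφ }⟩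

lemma projective_iff_retract (M : FPMod D) :
    Projective M ↔ ∃ A : D, Nonempty (Retract M (FPMod.repr A)) := by
  refine ⟨fun _ => ?_, fun ⟨A, ⟨r⟩⟩ => ?_⟩
  · obtain ⟨Y, φ, hφ⟩ := exists_epi_repr M
    exact ⟨Y, ⟨⟨Projective.factorThru (𝟙 M) φ, φ, Projective.factorThru_comp _ _⟩⟩⟩
  · have := projective_repr A
    exact r.projective

/-- The Yoneda embedding into `mod-D`. -/
def yonedaFP : D ⥤ FPMod D := (isFinPres D).lift preadditiveYoneda isFinPres_yoneda

instance : (yonedaFP (D := D)).Full := inferInstanceAs (ObjectProperty.lift _ _ _).Full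

instance : (yonedaFP (D := D)).Faithful := inferInstanceAs (ObjectProperty.lift _ _ _).Faithful

lemma projective_iff_iso [IsIdempotentComplete D] (M : FPMod D) :
    Projective M ↔ ∃ A : D, Nonempty (M ≅ FPMod.repr A) := by
  refine ⟨fun h => ?_, fun ⟨A, ⟨e⟩⟩ => ?_⟩
  · obtain ⟨A, ⟨r⟩⟩ := (projective_iff_retract M).1 h
    change Retract M (yonedaFP.obj A) at r
    -- By full faithfulness of Yoneda the idempotent cutting `M` out of the representable comes from
    -- an idempotent of `D`, and is split there.
    obtain ⟨p, hp⟩ := (yonedaFP (D := D)).map_surjective (X := A) (Y := A) (r.r ≫ r.i)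
    obtain ⟨B, i, q, hiq, hqi⟩ := IsIdempotentComplete.idempotents_split A p
      (yonedaFP.map_injective (by rw [Functor.map_comp, hp, Category.assoc, r.retract_assoc]))
    have hqi' : yonedaFP.map q ≫ yonedaFP.map i = r.r ≫ r.i := by rw [← Functor.map_comp, hqi, hp]
    have e : M ≅ yonedaFP.obj B :=
      { hom := r.i ≫ yonedaFP.map q
        inv := yonedaFP.map i ≫ r.r
        hom_inv_id := by
          rw [Category.assoc, reassoc_of% hqi', r.retract_assoc, r.retract]
        inv_hom_id := by
          rw [Category.assoc, ← reassoc_of% hqi', ← Functor.map_comp, ← Functor.map_comp_assoc,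
            hiq]
          simp only [CategoryTheory.Functor.map_id, Category.comp_id] }
    exact ⟨B, ⟨e⟩⟩
  · have := projective_repr A
    exact Projective.of_iso e.symm this

end Abelian

/-! ### The module presented by an arrow -/

section Coker

variable (C : Type u) [Category.{v} C] [Preadditive C]

/-- The functor sending `f : X ⟶ Y` to the cokernel of `C(-,X) ⟶ C(-,Y)`. -/
noncomputable def cokerYoneda : Arrow C ⥤ Cᵒᵖ ⥤ AddCommGrpCat.{v} where
  obj f := cokernel (preadditiveYoneda.map f.hom)
  map φ := cokernel.map _ _ (preadditiveYoneda.map φ.left) (preadditiveYoneda.map φ.right)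
    (by rw [← Functor.map_comp, ← Functor.map_comp, Arrow.w])
  map_id f := by
    rw [← cancel_epi (cokernel.π _), cokernel.π_desc, Arrow.id_right,
      CategoryTheory.Functor.map_id, Category.id_comp, Category.comp_id]
  map_comp φ ψ := by
    rw [← cancel_epi (cokernel.π _), cokernel.π_desc]
    simp

variable {C}

/-- The projection onto the module presented by an arrow. -/
noncomputable def cokerProj (f : Arrow C) :
    preadditiveYoneda.obj f.right ⟶ (cokerYoneda C).obj f :=
  cokernel.π (preadditiveYoneda.map f.hom)

lemma cokerProj_naturality {f f' : Arrow C} (φ : f ⟶ f') :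
    cokerProj f ≫ (cokerYoneda C).map φ = preadditiveYoneda.map φ.right ≫ cokerProj f' :=
  cokernel.π_desc _ _ _

/-- The generator of the module presented by an arrow. -/
noncomputable def cokerGen (f : Arrow C) : ((cokerYoneda C).obj f).obj (op f.right) :=
  ev (cokerProj f) f.right (toEl (𝟙 f.right))

lemma isPres_cokerYoneda (f : Arrow C) : IsPres ((cokerYoneda C).obj f) f.hom (cokerGen f) :=
  isPres_cokernel f.hom

instance (f : Arrow C) : ((cokerYoneda C).obj f).Additive :=
  additive_of_surjective (G := cokernel (preadditiveYoneda.map f.hom))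
    (cokernel.π (preadditiveYoneda.map f.hom)) (ev_surjective _)

lemma ev_cokerYoneda_map {f f' : Arrow C} (φ : f ⟶ f') :
    ev ((cokerYoneda C).map φ) f.right (cokerGen f) =
      res ((cokerYoneda C).obj f') φ.right (cokerGen f') := by
  have h' := congrArg (fun t => ev t f.right (toEl (𝟙 f.right))) (cokerProj_naturality φ)
  rw [ev_comp, ev_comp, ev_yoneda, Category.id_comp] at h'
  exact h'.trans (ev_yoneda_eq _ _)

/-- The image of the generator is represented by some `c`; that it is killed by `f` is what provides
the left leg of the square. -/
lemma cokerYoneda_map_surjective {f f' : Arrow C}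
    (m : (cokerYoneda C).obj f ⟶ (cokerYoneda C).obj f') :
    ∃ φ : f ⟶ f', (cokerYoneda C).map φ = m := by
  obtain ⟨c, hc⟩ := (isPres_cokerYoneda f').gen (ev m f.right (cokerGen f))
  obtain ⟨l, hl⟩ := ((isPres_cokerYoneda f').rel (f.hom ≫ c)).1 (by
    rw [res_comp, hc, ← ev_res, (isPres_cokerYoneda f).res_eq_zero, map_zero])
  exact ⟨Arrow.homMk l c hl, (isPres_cokerYoneda f).hom_ext
    ((ev_cokerYoneda_map _).trans hc)⟩

lemma cokerYoneda_map_eq_iff {f f' : Arrow C} (φ ψ : f ⟶ f') :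
    (cokerYoneda C).map φ = (cokerYoneda C).map ψ ↔
      ∃ h, h ≫ f'.hom = φ.right - ψ.right := by
  rw [← (isPres_cokerYoneda f').rel, res_sub, sub_eq_zero, ← ev_cokerYoneda_map,
    ← ev_cokerYoneda_map]
  exact ⟨fun h => by rw [h], (isPres_cokerYoneda f).hom_ext⟩

variable (C) in
/-- The functor sending `f : X ⟶ Y` to the cokernel of `C(-,X) ⟶ C(-,Y)` in `mod-C`. -/
noncomputable def cokerFP : Arrow C ⥤ FPMod C :=
  (isFinPres C).lift (cokerYoneda C) fun f => (isPres_cokerYoneda f).isFinPres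

instance : (cokerFP C).Full where
  map_surjective m := by
    obtain ⟨φ, hφ⟩ := cokerYoneda_map_surjective m.hom
    exact ⟨φ, ObjectProperty.hom_ext _ hφ⟩

lemma cokerFP_map_eq_iff {f f' : Arrow C} (φ ψ : f ⟶ f') :
    (cokerFP C).map φ = (cokerFP C).map ψ ↔ ∃ h, h ≫ f'.hom = φ.right - ψ.right := by
  rw [← cokerYoneda_map_eq_iff]
  exact ⟨fun h => congrArg (fun t => t.hom) h, fun h => ObjectProperty.hom_ext _ h⟩

/-- A presented module depends only on the set of morphisms that factor through the presenting
arrow. The sources of the two arrows need not be related. -/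
lemma nonempty_cokerYoneda_iso {f : Arrow C} {M : Cᵒᵖ ⥤ AddCommGrpCat.{v}} [M.Additive] {X Y : C}
    {g : X ⟶ Y} {y : M.obj (op Y)} (hM : IsPres M g y) (e : f.right ≅ Y)
    (h : ∀ {T : C} (t : T ⟶ f.right), (∃ k, k ≫ f.hom = t) ↔ ∃ k, k ≫ g = t ≫ e.hom) :
    Nonempty ((cokerYoneda C).obj f ≅ M) := by
  have hf := isPres_cokerYoneda f
  obtain ⟨φ, hφ⟩ := hf.exists_hom (res M e.hom y) (by
    rw [← res_comp, hM.rel, ← h]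
    exact ⟨𝟙 _, Category.id_comp _⟩)
  have := hf.isIso hM φ e.hom hφ (fun g => ⟨g ≫ e.inv, by simp⟩)
    (fun t ht => (hf.rel t).2 ((h t).2 ((hM.rel _).1 ht)))
  exact ⟨asIso φ⟩

lemma nonempty_cokerFP_iso {f : Arrow C} {M : FPMod C} {X Y : C} {g : X ⟶ Y}
    {y : M.obj.obj (op Y)} (hM : IsPres M.obj g y) (e : f.right ≅ Y)
    (h : ∀ {T : C} (t : T ⟶ f.right), (∃ k, k ≫ f.hom = t) ↔ ∃ k, k ≫ g = t ≫ e.hom) :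
    Nonempty ((cokerFP C).obj f ≅ M) := by
  have := M.property.1
  obtain ⟨i⟩ := nonempty_cokerYoneda_iso hM e h
  exact ⟨(isFinPres C).isoMk i⟩

end Coker

/-! ### Restriction along a full additive functor -/

section Restriction

variable {C : Type u} [Category.{v} C] [Preadditive C]
  {D : Type u} [Category.{v} D] [Preadditive D] (p : C ⥤ D) [p.Additive] [p.Full]

/-- An element of a `D`-module as an element of its restriction to `C`. -/
def restrictEl (G : Dᵒᵖ ⥤ AddCommGrpCat.{v}) {Y : C} (y : G.obj (op (p.obj Y))) :
    (p.op ⋙ G).obj (op Y) := y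

/-- A factorization over `D` lifts to one over `C` up to a morphism killed by `p`, and by `hf` this
error factors through `f` as well. -/
lemma isPres_restrict {G : Dᵒᵖ ⥤ AddCommGrpCat.{v}} {X Y : C} {f : X ⟶ Y}
    {y : G.obj (op (p.obj Y))} (hG : IsPres G (p.map f) y)
    (hf : ∀ {T : C} (g : T ⟶ Y), p.map g = 0 → ∃ h, h ≫ f = g) :
    IsPres (p.op ⋙ G) f (restrictEl p G y) where
  gen {T} x := by
    obtain ⟨g, hg⟩ := hG.gen x
    obtain ⟨g, rfl⟩ := p.map_surjective g
    exact ⟨g, hg⟩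
  rel {T} g := by
    refine (hG.rel (p.map g)).trans ⟨fun ⟨h, hh⟩ => ?_, fun ⟨h, hh⟩ => ⟨p.map h, by
      rw [← p.map_comp, hh]⟩⟩
    obtain ⟨h, rfl⟩ := p.map_surjective h
    obtain ⟨k, hk⟩ := hf (g - h ≫ f) (by rw [p.map_sub, p.map_comp, hh, sub_self])
    exact ⟨h + k, by rw [Preadditive.add_comp, hk, add_sub_cancel]⟩

variable {𝒮 : Type u₁} [Category.{v₁} 𝒮] (Λ : 𝒮 ⥤ Arrow C)

/-- The functor to `mod-D` induced by a family of arrows of `C`. -/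
noncomputable abbrev presFunctor : 𝒮 ⥤ FPMod D := Λ ⋙ p.mapArrow ⋙ cokerFP D

variable (hker : ∀ (X : 𝒮) {T : C} (g : T ⟶ (Λ.obj X).right), p.map g = 0 →
  ∃ h, h ≫ (Λ.obj X).hom = g)

include hker

/-- Both sides have the same generator and, by `isPres_restrict`, the same relations over `C`.
Naturality is checked on the generator. -/
lemma nonempty_presFunctor_restrict_iso :
    Nonempty (presFunctor p Λ ⋙ (isFinPres D).ι ⋙ (Functor.whiskeringLeft _ _ _).obj p.op ≅
      Λ ⋙ cokerYoneda C) := by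
  have hG : ∀ X : 𝒮, IsPres (p.op ⋙ (cokerYoneda D).obj (p.mapArrow.obj (Λ.obj X)))
      (Λ.obj X).hom (restrictEl p _ (cokerGen (p.mapArrow.obj (Λ.obj X)))) := fun X =>
    isPres_restrict p (isPres_cokerYoneda (p.mapArrow.obj (Λ.obj X))) (hker X)
  have hadd : ∀ X : 𝒮, (p.op ⋙ (cokerYoneda D).obj (p.mapArrow.obj (Λ.obj X))).Additive :=
    fun X => inferInstance
  choose φ hφ using fun X : 𝒮 => (isPres_cokerYoneda (Λ.obj X)).exists_hom
    (G := p.op ⋙ (cokerYoneda D).obj (p.mapArrow.obj (Λ.obj X))) _ (hG X).res_eq_zero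
  have hiso : ∀ X : 𝒮, IsIso (φ X) := fun X =>
    (isPres_cokerYoneda (Λ.obj X)).isIso (hG X) (φ X) (𝟙 _) (by rw [hφ, res_id])
      (fun g => ⟨g, by simp⟩)
      (fun {_} g hg => ((isPres_cokerYoneda (Λ.obj X)).rel g).2 (((hG X).rel g).1 (by simpa using hg)))
  have hnat : ∀ {X Y : 𝒮} (a : X ⟶ Y), (cokerYoneda C).map (Λ.map a) ≫ φ Y =
      φ X ≫ Functor.whiskerLeft p.op ((cokerYoneda D).map (p.mapArrow.map (Λ.map a))) := by
    intro X Y a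
    refine (isPres_cokerYoneda (Λ.obj X)).hom_ext ?_
    rw [ev_comp, ev_comp, hφ, ev_cokerYoneda_map, ev_res, hφ]
    exact (ev_cokerYoneda_map (p.mapArrow.map (Λ.map a))).symm
  exact ⟨(NatIso.ofComponents (F := Λ ⋙ cokerYoneda C) (G := presFunctor p Λ ⋙
    (isFinPres D).ι ⋙ (Functor.whiskeringLeft _ _ _).obj p.op)
      (fun X => @asIso _ _ _ _ (φ X) (hiso X)) hnat).symm⟩

lemma presFunctor_map_eq_iff {X Y : 𝒮} (φ ψ : X ⟶ Y) :
    (presFunctor p Λ).map φ = (presFunctor p Λ).map ψ ↔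
      ∃ h, h ≫ (Λ.obj Y).hom = (Λ.map φ).right - (Λ.map ψ).right := by
  refine (cokerFP_map_eq_iff (p.mapArrow.map (Λ.map φ)) (p.mapArrow.map (Λ.map ψ))).trans
    ⟨fun ⟨h, hh⟩ => ?_, fun ⟨h, hh⟩ => ⟨p.map h, ?_⟩⟩
  · obtain ⟨h, rfl⟩ := p.map_surjective h
    change p.map h ≫ p.map (Λ.obj Y).hom = p.map (Λ.map φ).right - p.map (Λ.map ψ).right at hh
    obtain ⟨k, hk⟩ := hker Y ((Λ.map φ).right - (Λ.map ψ).right - h ≫ (Λ.obj Y).hom)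
      (by rw [p.map_sub, p.map_sub, p.map_comp, hh, sub_self])
    exact ⟨h + k, by rw [Preadditive.add_comp, hk, add_sub_cancel]⟩
  · change p.map h ≫ p.map (Λ.obj Y).hom = p.map (Λ.map φ).right - p.map (Λ.map ψ).right
    rw [← p.map_comp, hh, p.map_sub]

lemma presFunctor_full (hlift : ∀ (X Y : 𝒮) (c : (Λ.obj X).right ⟶ (Λ.obj Y).right),
    (∃ l, l ≫ (Λ.obj Y).hom = (Λ.obj X).hom ≫ c) → ∃ φ : X ⟶ Y, (Λ.map φ).right = c) :
    (presFunctor p Λ).Full where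
  map_surjective {X Y} m := by
    obtain ⟨φ, rfl⟩ := (cokerFP D).map_surjective
      (X := p.mapArrow.obj (Λ.obj X)) (Y := p.mapArrow.obj (Λ.obj Y)) m
    obtain ⟨c, hc⟩ := p.map_surjective (X := (Λ.obj X).right) (Y := (Λ.obj Y).right) φ.right
    obtain ⟨l, hl⟩ := p.map_surjective (X := (Λ.obj X).left) (Y := (Λ.obj Y).left) φ.left
    have hw : p.map l ≫ p.map (Λ.obj Y).hom = p.map (Λ.obj X).hom ≫ p.map c := by
      rw [hl, hc]
      exact φ.w
    -- The lifted square commutes only after applying `p`; the defect of commutativity factors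
    -- through the target arrow and is absorbed into the left leg.
    obtain ⟨k, hk⟩ := hker Y ((Λ.obj X).hom ≫ c - l ≫ (Λ.obj Y).hom)
      (by rw [p.map_sub, p.map_comp, p.map_comp, hw, sub_self])
    obtain ⟨ψ, hψ⟩ := hlift X Y c ⟨l + k, by rw [Preadditive.add_comp, hk, add_sub_cancel]⟩
    -- The left component of `ψ` need not lift that of `φ`. The right components agree, which
    -- suffices, so the factorization of their difference is `0`.
    refine ⟨ψ, (cokerFP_map_eq_iff (p.mapArrow.map (Λ.map ψ)) φ).2 ⟨0, ?_⟩⟩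
    rw [zero_comp, ← hc, ← hψ]
    exact (sub_self (p.map (Λ.map ψ).right)).symm

omit hker in
omit [p.Full] [p.Additive] in
omit [Preadditive C] in
lemma presFunctor_essSurj (hess : ∀ {A B : D} (f : A ⟶ B), ∃ (X : 𝒮)
    (e : p.obj (Λ.obj X).right ≅ B), ∀ {T : D} (t : T ⟶ p.obj (Λ.obj X).right),
      (∃ k, k ≫ p.map (Λ.obj X).hom = t) ↔ ∃ k, k ≫ f = t ≫ e.hom) :
    (presFunctor p Λ).EssSurj where
  mem_essImage M := by
    obtain ⟨A, B, f, y, hy⟩ := exists_isPres M.property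
    obtain ⟨X, e, he⟩ := hess f
    exact ⟨X, nonempty_cokerFP_iso (f := p.mapArrow.obj (Λ.obj X)) hy e he⟩

end Restriction

/-! ### Quotient categories -/

section Quotient

variable {𝒮 : Type u₁} [Category.{v₁} 𝒮] (r : HomRel 𝒮) [Congruence r]
  {ℰ : Type u} [Category.{v} ℰ] (K : 𝒮 ⥤ ℰ)
  (hr : ∀ (X Y : 𝒮) (φ ψ : X ⟶ Y), r φ ψ ↔ K.map φ = K.map ψ)

omit [Congruence r] in
lemma quotient_lift_isEquivalence [K.Full] [K.EssSurj] :
    (CategoryTheory.Quotient.lift r K fun X Y φ ψ h => (hr X Y φ ψ).1 h).IsEquivalence where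
  faithful := ⟨fun {X Y} f g h => by
    obtain ⟨f, rfl⟩ := (CategoryTheory.Quotient.functor r).map_surjective f
    obtain ⟨g, rfl⟩ := (CategoryTheory.Quotient.functor r).map_surjective g
    exact CategoryTheory.Quotient.sound r ((hr _ _ _ _).2 h)⟩
  full := ⟨fun {X Y} m => by
    obtain ⟨φ, hφ⟩ := K.map_surjective (X := X.as) (Y := Y.as) m
    exact ⟨(CategoryTheory.Quotient.functor r).map φ, hφ⟩⟩
  essSurj := ⟨fun E => by
    obtain ⟨X, ⟨e⟩⟩ := Functor.EssSurj.mem_essImage (F := K) E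
    exact ⟨(CategoryTheory.Quotient.functor r).obj X, ⟨e⟩⟩⟩

end Quotient

/-! ### Ideal quotients -/

section IdealQuotient

variable {C : Type u} [Category.{v} C] [Preadditive C] [HasBinaryBiproducts C]
  (W : ObjectProperty C) [IsSumClosed W]

instance : (idealProj W).Additive := CategoryTheory.Quotient.functor_additive _ _

lemma idealProj_map_eq_zero_iff {X Y : C} (f : X ⟶ Y) :
    (idealProj W).map f = 0 ↔ ∃ (Q : C) (_ : W Q) (a : X ⟶ Q) (b : Q ⟶ Y), f = a ≫ b := by
  rw [← (idealProj W).map_zero, CategoryTheory.Quotient.functor_map_eq_iff]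
  simp only [idealRel, sub_zero]

instance : HasBinaryBiproducts (IdealQuotient W) where
  has_binary_biproduct X Y := hasBinaryBiproduct_of_total
    ((idealProj W).mapBinaryBicone (BinaryBiproduct.bicone X.as Y.as)) (by
      change (idealProj W).map _ ≫ (idealProj W).map _ +
        (idealProj W).map _ ≫ (idealProj W).map _ = 𝟙 _
      rw [← Functor.map_comp, ← Functor.map_comp]
      exact (idealProj W).map_add.symm.trans
        ((congrArg (idealProj W).map biprod.total).trans ((idealProj W).map_id _)))

instance [HasZeroObject C] : HasZeroObject (IdealQuotient W) where
  zero := by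
    obtain ⟨Z, hZ⟩ := HasZeroObject.zero (C := C)
    exact ⟨_, (idealProj W).map_isZero hZ⟩

end IdealQuotient

/-! ### Functoriality of extensions -/

section PushPull

variable {C : Type u} [Category.{v} C] (E : Cᵒᵖ ⥤ C ⥤ AddCommGrpCat.{v})

@[simp]
lemma push_id {Z A : C} (δ : Ext E Z A) : push E (𝟙 A) δ = δ := by simp [push]

@[simp]
lemma pull_id {Z A : C} (δ : Ext E Z A) : pull E (𝟙 Z) δ = δ := by simp [pull]

lemma push_comp {Z A A' A'' : C} (a : A ⟶ A') (b : A' ⟶ A'') (δ : Ext E Z A) :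
    push E (a ≫ b) δ = push E b (push E a δ) := by simp [push]

lemma pull_comp {Z Z' Z'' A : C} (c : Z'' ⟶ Z') (d : Z' ⟶ Z) (δ : Ext E Z A) :
    pull E (c ≫ d) δ = pull E c (pull E d δ) := by simp [pull]

lemma push_pull {Z Z' A A' : C} (a : A ⟶ A') (c : Z' ⟶ Z) (δ : Ext E Z A) :
    push E a (pull E c δ) = pull E c (push E a δ) :=
  ConcreteCategory.congr_hom ((E.map c.op).naturality a) δ |>.symm

end PushPull

namespace ExangulatedStructure

variable {n : ℕ} {C : Type u} [Category.{v} C] [Preadditive C] [HasZeroObject C]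
  [HasBinaryBiproducts C] (S : ExangulatedStructure n C)

lemma push_add {Z A A' : C} (a b : A ⟶ A') (δ : Ext S.E Z A) :
    push S.E (a + b) δ = push S.E a δ + push S.E b δ := by
  have := S.additive_right (op Z)
  simp [push, Functor.map_add]

lemma pull_add {Z Z' A : C} (c d : Z' ⟶ Z) (δ : Ext S.E Z A) :
    pull S.E (c + d) δ = pull S.E c δ + pull S.E d δ := by
  have := S.additive_left
  simp [pull, Functor.map_add]

lemma push_sub {Z A A' : C} (a b : A ⟶ A') (δ : Ext S.E Z A) :
    push S.E (a - b) δ = push S.E a δ - push S.E b δ := by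
  rw [eq_sub_iff_add_eq, ← push_add, sub_add_cancel]

lemma pull_sub {Z Z' A : C} (c d : Z' ⟶ Z) (δ : Ext S.E Z A) :
    pull S.E (c - d) δ = pull S.E c δ - pull S.E d δ := by
  rw [eq_sub_iff_add_eq, ← pull_add, sub_add_cancel]

@[simp]
lemma zero_push {Z A A' : C} (δ : Ext S.E Z A) : push S.E (0 : A ⟶ A') δ = 0 := by
  have := S.push_sub 0 (0 : A ⟶ A') δ
  simpa using this

@[simp]
lemma zero_pull {Z Z' A : C} (δ : Ext S.E Z A) : pull S.E (0 : Z' ⟶ Z) δ = 0 := by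
  have := S.pull_sub 0 (0 : Z' ⟶ Z) δ
  simpa using this

lemma exists_realizes {Z A : C} (δ : Ext S.E Z A) : ∃ X : Cpx n A Z, Realizes S.s X δ := by
  obtain ⟨X, hX⟩ := Quotient.exists_rep (S.s δ)
  exact ⟨X, hX.symm⟩

variable {S}

lemma pull_eq_zero_iff {Z A : C} {X : Cpx n A Z} {δ : Ext S.E Z A} (h : Realizes S.s X δ) {T : C}
    (c : T ⟶ Z) : pull S.E c δ = 0 ↔ ∃ g, g ≫ X.dLast = c :=
  ⟨(S.isExangle X δ h).contra_last T c, fun ⟨g, hg⟩ => by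
    rw [← hg, pull_comp, (S.isExangle X δ h).pull_dLast, map_zero]⟩

lemma push_eq_zero_iff {Z A : C} {X : Cpx n A Z} {δ : Ext S.E Z A} (h : Realizes S.s X δ) {T : C}
    (a : A ⟶ T) : push S.E a δ = 0 ↔ ∃ g, X.dFirst ≫ g = a :=
  ⟨(S.isExangle X δ h).co_first T a, fun ⟨g, hg⟩ => by
    rw [← hg, push_comp, (S.isExangle X δ h).push_dFirst, map_zero]⟩

end ExangulatedStructure

/-! ### Mapping cones -/

section Cones

variable {C : Type u} [Category.{v} C] [Preadditive C] [HasBinaryBiproducts C] {n : ℕ}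

omit [HasBinaryBiproducts C] in
lemma factors_iff_of_isIso_lift {M X Y Z T : C} [HasBinaryBiproduct X Y] (p : M ⟶ X) (q : M ⟶ Y)
    (_ : IsIso (biprod.lift p q)) (c : X ⟶ Z) (d : Y ⟶ Z) (t : T ⟶ Z) :
    (∃ w, w ≫ (p ≫ c + q ≫ d) = t) ↔ ∃ u v, u ≫ c + v ≫ d = t := by
  constructor
  · rintro ⟨w, rfl⟩
    exact ⟨w ≫ p, w ≫ q, by simp⟩
  · rintro ⟨u, v, rfl⟩
    refine ⟨biprod.lift u v ≫ inv (biprod.lift p q), ?_⟩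
    have h : p ≫ c + q ≫ d = biprod.lift p q ≫ biprod.desc c d := by simp
    rw [h, Category.assoc, IsIso.inv_hom_id_assoc, biprod.lift_desc]

omit [HasBinaryBiproducts C] in
lemma cofactors_iff_of_isIso_lift {A M X Y T : C} [HasBinaryBiproduct X Y] (p : M ⟶ X)
    (q : M ⟶ Y) (_ : IsIso (biprod.lift p q)) {e : A ⟶ M} {a : A ⟶ X} {b : A ⟶ Y} (ha : e ≫ p = a)
    (hb : e ≫ q = b) (t : A ⟶ T) :
    (∃ w, e ≫ w = t) ↔ ∃ u v, a ≫ u + b ≫ v = t := by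
  have h : e ≫ biprod.lift p q = biprod.lift a b := by ext <;> simp [ha, hb]
  constructor
  · rintro ⟨w, rfl⟩
    refine ⟨biprod.inl ≫ inv (biprod.lift p q) ≫ w, biprod.inr ≫ inv (biprod.lift p q) ≫ w, ?_⟩
    have he : e = biprod.lift a b ≫ inv (biprod.lift p q) := by
      rw [← h, Category.assoc, IsIso.hom_inv_id, Category.comp_id]
    rw [he, show biprod.lift a b = a ≫ biprod.inl + b ≫ biprod.inr from biprod.lift_eq]
    simp
  · rintro ⟨u, v, rfl⟩
    exact ⟨biprod.lift p q ≫ biprod.desc u v, by rw [reassoc_of% h, biprod.lift_desc]⟩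

/-- The last differential of the cone is `(c, d) : Xₙ₊₁ ⊞ Yₙ ⟶ Yₙ₊₁`, up to the identifications of
the end terms. -/
lemma MappingCone.factors_dLast_iff (hn : 0 < n) {A A' Z Z' : C} {X : Cpx n A Z} {Y : Cpx n A' Z'}
    {f : X.K ⟶ Y.K} (N : MappingCone n f) {a : A ⟶ A'} {c : Z ⟶ Z'} (hf : IsLift X Y a c f)
    {T : C} (t : T ⟶ Z') :
    (∃ w, w ≫ N.toCpx.dLast = t) ↔
      ∃ (u : T ⟶ Z) (v : T ⟶ Y.K.X n), u ≫ c + v ≫ Y.dLast = t := by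
  -- The last differential starts in degree `n`, so it is `d_q_succ` at the index `n - 1`.
  obtain ⟨m, rfl⟩ : ∃ m, n = m + 1 := ⟨n - 1, by omega⟩
  have hd : N.toCpx.dLast = N.p (m + 1) ≫ X.lst.hom ≫ c + N.q m ≫ Y.dLast := by
    have : N.toCpx.dLast = (N.M.d (m + 1) (m + 2) ≫ N.q (m + 1)) ≫ Y.lst.hom := by
      simp [Cpx.dLast, MappingCone.toCpx]
    rw [this, N.d_q_succ m (by omega), Preadditive.add_comp, Category.assoc, Category.assoc,
      ← hf.lst]
    rfl
  rw [hd]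
  refine (factors_iff_of_isIso_lift _ _ (N.iso_mid m (by omega)) _ _ t).trans
    ⟨fun ⟨u, v, h⟩ => ⟨u ≫ X.lst.hom, v, ?_⟩, fun ⟨u, v, h⟩ => ⟨u ≫ X.lst.inv, v, ?_⟩⟩
  · rwa [Category.assoc]
  · rwa [Category.assoc, Iso.inv_hom_id_assoc]

lemma MappingCocone.factors_dFirst_iff (hn : 0 < n) {A A' Z Z' : C} {X : Cpx n A Z}
    {Y : Cpx n A' Z'} {f : X.K ⟶ Y.K} (N : MappingCocone n f) {a : A ⟶ A'} {c : Z ⟶ Z'}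
    (hf : IsLift X Y a c f) {T : C} (t : A ⟶ T) :
    (∃ w, N.toCpx.dFirst ≫ w = t) ↔
      ∃ (u : X.K.X 1 ⟶ T) (v : A' ⟶ T), X.dFirst ≫ u + a ≫ v = t := by
  have := N.iso_first
  have h₁ : N.toCpx.dFirst ≫ N.p 1 = X.dFirst := by
    simp [Cpx.dFirst, MappingCocone.toCpx, N.d_p 0 hn]
  have h₂ : N.toCpx.dFirst ≫ N.q 0 = a ≫ Y.fst.inv := by
    have hl := hf.fst
    rw [← Iso.eq_comp_inv] at hl
    simp [Cpx.dFirst, MappingCocone.toCpx, N.d_q_zero, hl]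
  refine (cofactors_iff_of_isIso_lift (N.p (0 + 1)) (N.q 0) (N.iso_mid 0 hn) h₁ h₂ t).trans
    ⟨fun ⟨u, v, h⟩ => ⟨u, Y.fst.inv ≫ v, ?_⟩, fun ⟨u, v, h⟩ => ⟨u, Y.fst.hom ≫ v, ?_⟩⟩
  · rwa [Category.assoc] at h
  · rwa [Category.assoc, Iso.inv_hom_id_assoc]

end Cones

namespace ExangulatedStructure

variable {n : ℕ} {C : Type u} [Category.{v} C] [Preadditive C] [HasZeroObject C]
  [HasBinaryBiproducts C] {S : ExangulatedStructure n C}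

/-- Exactness of `C(-,Z) ⟶ 𝔼(-,A) ⟶ 𝔼(-,X₁)`. -/
lemma exists_pull (hn : 0 < n) {Z A : C} {X : Cpx n A Z} {δ : Ext S.E Z A}
    (h : Realizes S.s X δ) {T : C} (ε : Ext S.E T A) (hε : push S.E X.dFirst ε = 0) :
    ∃ c : T ⟶ Z, pull S.E c δ = ε := by
  -- The extension `(ε, δ)` restricts to `δ` on `Z`, so a good lift of the inclusion of `Z` can
  -- start at `X`; both components die under the first differential of `X`.
  let ρ : Ext S.E (T ⊞ Z) A := pull S.E biprod.fst ε + pull S.E biprod.snd δ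
  have hρ₁ : pull S.E biprod.inl ρ = ε := by
    simp only [ρ, map_add, ← pull_comp, biprod.inl_fst, biprod.inl_snd, pull_id, zero_pull,
      add_zero]
  have hρ₂ : pull S.E biprod.inr ρ = δ := by
    simp only [ρ, map_add, ← pull_comp, biprod.inr_fst, biprod.inr_snd, pull_id, zero_pull,
      zero_add]
  have hρ₃ : push S.E X.dFirst ρ = 0 := by
    simp only [ρ, map_add, push_pull, hε, (S.isExangle X δ h).push_dFirst, map_zero, add_zero]
  obtain ⟨Y, hY⟩ := S.exists_realizes ρ
  obtain ⟨f, hf, N, hN⟩ := S.good_lift ρ biprod.inr X Y (by rwa [hρ₂]) hY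
  rw [hρ₃] at hN
  -- The cone now realizes the zero extension, so every morphism factors through its last
  -- differential. Applied to `biprod.inl` this gives `inl = u ≫ inr + v ≫ d`; pulling `ρ` back
  -- along it kills the second summand and leaves `ε = u^* δ`.
  obtain ⟨u, v, huv⟩ := (N.factors_dLast_iff hn hf (biprod.inl : T ⟶ T ⊞ Z)).1
    ((pull_eq_zero_iff hN _).1 (map_zero _))
  refine ⟨u, ?_⟩
  have := congrArg (fun t => pull S.E t ρ) huv
  rw [pull_add, pull_comp, pull_comp, (S.isExangle Y ρ hY).pull_dLast, map_zero, add_zero, hρ₁,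
    hρ₂] at this
  exact this

/-- Exactness of `C(A,-) ⟶ 𝔼(Z,-) ⟶ 𝔼(Xₙ,-)`. -/
lemma exists_push (hn : 0 < n) {Z A : C} {X : Cpx n A Z} {δ : Ext S.E Z A}
    (h : Realizes S.s X δ) {T : C} (ε : Ext S.E Z T) (hε : pull S.E X.dLast ε = 0) :
    ∃ a : A ⟶ T, push S.E a δ = ε := by
  let ρ : Ext S.E Z (T ⊞ A) := push S.E biprod.inl ε + push S.E biprod.inr δ
  have hρ₁ : push S.E biprod.fst ρ = ε := by
    simp only [ρ, map_add, ← push_comp, biprod.inl_fst, biprod.inr_fst, push_id, zero_push,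
      add_zero]
  have hρ₂ : push S.E biprod.snd ρ = δ := by
    simp only [ρ, map_add, ← push_comp, biprod.inl_snd, biprod.inr_snd, push_id, zero_push,
      zero_add]
  have hρ₃ : pull S.E X.dLast ρ = 0 := by
    simp only [ρ, map_add, ← push_pull, hε, (S.isExangle X δ h).pull_dLast, map_zero, add_zero]
  obtain ⟨Y, hY⟩ := S.exists_realizes ρ
  -- Dually, the projection `T ⊞ A ⟶ A` pushes `ρ` to `δ`, and the cocone realizes `0`.
  obtain ⟨f, hf, N, hN⟩ := S.good_lift_op ρ biprod.snd Y X hY (by rwa [hρ₂])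
  rw [hρ₃] at hN
  obtain ⟨u, v, huv⟩ := (N.factors_dFirst_iff hn hf (biprod.fst : T ⊞ A ⟶ T)).1
    ((push_eq_zero_iff hN _).1 (map_zero _))
  refine ⟨v, ?_⟩
  have := congrArg (fun t => push S.E t ρ) huv
  rw [push_add, push_comp, push_comp, (S.isExangle Y ρ hY).push_dFirst, map_zero, zero_add, hρ₁,
    hρ₂] at this
  exact this

/-- The identity of `I` extends along the first differential of any realization, and the first
differential pushes the extension to zero. -/
lemma ext_eq_zero_of_inj {I : C} (hI : S.inj I) {T : C} (ε : Ext S.E T I) : ε = 0 := by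
  obtain ⟨X, hX⟩ := S.exists_realizes ε
  have := (push_eq_zero_iff hX (𝟙 I)).2 (hI X ε hX (𝟙 I))
  rwa [push_id] at this

lemma ext_eq_zero_of_proj {P : C} (hP : S.proj P) {T : C} (ε : Ext S.E P T) : ε = 0 := by
  obtain ⟨X, hX⟩ := S.exists_realizes ε
  have := (pull_eq_zero_iff hX (𝟙 P)).2 (hP X ε hX (𝟙 P))
  rwa [pull_id] at this

/-! ### Distinguished `n`-exangles as objects of `S(C)` -/

/-- The underlying complex with end terms. -/
abbrev Exangle.cpx (W : S.Exangle) : Cpx n (W.K.X 0) (W.K.X (n + 1)) :=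
  ⟨W.K, W.isZero, Iso.refl _, Iso.refl _⟩

lemma Exangle.dFirst_cpx (W : S.Exangle) : W.cpx.dFirst = W.K.d 0 1 := Category.id_comp _

lemma Exangle.dLast_cpx (W : S.Exangle) : W.cpx.dLast = W.K.d n (n + 1) := Category.comp_id _

lemma Exangle.pull_eq_zero_iff (W : S.Exangle) {T : C} (c : T ⟶ W.K.X (n + 1)) :
    pull S.E c W.δ = 0 ↔ ∃ g, g ≫ W.K.d n (n + 1) = c := by
  rw [ExangulatedStructure.pull_eq_zero_iff W.realizes, W.dLast_cpx]

lemma Exangle.push_eq_zero_iff (W : S.Exangle) {T : C} (a : W.K.X 0 ⟶ T) :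
    push S.E a W.δ = 0 ↔ ∃ g, W.K.d 0 1 ≫ g = a := by
  rw [ExangulatedStructure.push_eq_zero_iff W.realizes, W.dFirst_cpx]

lemma exists_exangle_of_eq {K : CochainComplex C ℕ} (hK : ∀ i, n + 1 < i → IsZero (K.X i))
    {Z A : C} (h₀ : K.X 0 = A) (h₁ : K.X (n + 1) = Z) (δ : Ext S.E Z A)
    (h : Realizes S.s ⟨K, hK, eqToIso h₀, eqToIso h₁⟩ δ) : ∃ W : S.Exangle, W.K = K := by
  subst h₀ h₁
  exact ⟨⟨K, hK, δ, h⟩, rfl⟩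

/-- Transport of a complex along isomorphisms of its terms. -/
def _root_.CochainComplex.transport (K : CochainComplex C ℕ) (X : ℕ → C)
    (e : ∀ i, X i ≅ K.X i) : CochainComplex C ℕ where
  X := X
  d i j := (e i).hom ≫ K.d i j ≫ (e j).inv
  shape i j h := by rw [K.shape i j h]; simp
  d_comp_d' i j k _ _ := by simp

/-- The transported complex is isomorphic to the original one. -/
def _root_.CochainComplex.transportIso (K : CochainComplex C ℕ) (X : ℕ → C)
    (e : ∀ i, X i ≅ K.X i) : K.transport X e ≅ K :=
  HomologicalComplex.Hom.isoOfComponents e fun i j _ => by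
    change (e i).hom ≫ K.d i j = ((e i).hom ≫ K.d i j ≫ (e j).inv) ≫ (e j).hom
    simp

/-- A `Cpx` identifies its end terms with `A`, `Z` only up to isomorphism, while an object of `S(C)`
carries an extension of the end terms themselves. Instead of moving `δ`, the complex is replaced by
an isomorphic one whose end terms equal `A` and `Z`. -/
lemma exists_exangle_iso {Z A : C} {X : Cpx n A Z} {δ : Ext S.E Z A} (h : Realizes S.s X δ) :
    ∃ W : S.Exangle, Nonempty (W.K ≅ X.K) := by
  let X' : ℕ → C := fun i => if i = 0 then A else if i = n + 1 then Z else X.K.X i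
  have h₀ : X' 0 = A := if_pos rfl
  have h₁ : X' (n + 1) = Z := by simp [X']
  obtain ⟨e, he₀, he₁⟩ : ∃ e : ∀ i, X' i ≅ X.K.X i, (e 0).hom ≫ X.fst.hom = eqToHom h₀ ∧
      (e (n + 1)).hom ≫ X.lst.hom = eqToHom h₁ := by
    have : ∀ i, ∃ e : X' i ≅ X.K.X i,
        (∀ hi : i = 0, e.hom ≫ eqToHom (by rw [hi]) ≫ X.fst.hom = eqToHom (by rw [hi, h₀])) ∧
        (∀ hi : i = n + 1, e.hom ≫ eqToHom (by rw [hi]) ≫ X.lst.hom =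
          eqToHom (by rw [hi, h₁])) := by
      intro i
      by_cases hi₀ : i = 0
      · subst hi₀
        exact ⟨eqToIso h₀ ≪≫ X.fst.symm, fun _ => by simp, fun hi => by omega⟩
      by_cases hi₁ : i = n + 1
      · subst hi₁
        exact ⟨eqToIso h₁ ≪≫ X.lst.symm, fun hi => by omega, fun _ => by simp⟩
      · exact ⟨eqToIso (by simp [X', hi₀, hi₁]), fun hi => absurd hi hi₀, fun hi => absurd hi hi₁⟩
    choose e he using this
    exact ⟨e, by simpa using (he 0).1 rfl, by simpa using (he (n + 1)).2 rfl⟩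
  let K' := X.K.transport X' e
  let φ : K' ≅ X.K := X.K.transportIso X' e
  have hK' : ∀ i, n + 1 < i → IsZero (K'.X i) := fun i hi => (X.isZero i hi).of_iso (e i)
  let Y : Cpx n A Z := ⟨K', hK', eqToIso h₀, eqToIso h₁⟩
  have hY : Realizes S.s Y δ := by
    -- The chosen isomorphisms are compatible with the end identifications, so they form a homotopy
    -- equivalence with fixed ends and the class of `X` is unchanged.
    refine (show S.s δ = _ from h).trans (Quotient.sound ?_)
    refine ⟨φ.inv, φ.hom, ⟨?_, ?_⟩, ⟨?_, ?_⟩, ⟨Homotopy.ofEq φ.inv_hom_id⟩,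
      ⟨Homotopy.ofEq φ.hom_inv_id⟩⟩
    · change (e 0).inv ≫ eqToHom h₀ = X.fst.hom ≫ 𝟙 A
      rw [← he₀, Iso.inv_hom_id_assoc, Category.comp_id]
    · change (e (n + 1)).inv ≫ eqToHom h₁ = X.lst.hom ≫ 𝟙 Z
      rw [← he₁, Iso.inv_hom_id_assoc, Category.comp_id]
    · exact he₀.trans (Category.comp_id _).symm
    · exact he₁.trans (Category.comp_id _).symm
  obtain ⟨W, hW⟩ := exists_exangle_of_eq hK' h₀ h₁ δ hY
  exact ⟨W, ⟨eqToIso hW ≪≫ φ⟩⟩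

lemma exists_exangle {Z A : C} {X : Cpx n A Z} {δ : Ext S.E Z A} (h : Realizes S.s X δ) :
    ∃ (W : S.Exangle) (e₀ : A ≅ W.K.X 0) (e₁ : W.K.X (n + 1) ≅ Z),
      (∀ {T : C} (t : W.K.X 0 ⟶ T), (∃ k, W.K.d 0 1 ≫ k = t) ↔
        ∃ k, X.dFirst ≫ k = e₀.hom ≫ t) ∧
      (∀ {T : C} (t : T ⟶ W.K.X (n + 1)), (∃ k, k ≫ W.K.d n (n + 1) = t) ↔
        ∃ k, k ≫ X.dLast = t ≫ e₁.hom) := by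
  obtain ⟨W, ⟨φ⟩⟩ := exists_exangle_iso h
  let e : ∀ i, W.K.X i ≅ X.K.X i := fun i => HomologicalComplex.Hom.isoApp φ i
  have hc : ∀ i j, (e i).hom ≫ X.K.d i j = W.K.d i j ≫ (e j).hom := fun i j => φ.hom.comm i j
  refine ⟨W, X.fst.symm ≪≫ (e 0).symm, e (n + 1) ≪≫ X.lst, fun t => ?_, fun t => ?_⟩
  · have h₀ : W.K.d 0 1 = (e 0).hom ≫ X.fst.hom ≫ X.dFirst ≫ (e 1).inv := by
      rw [Cpx.dFirst, Category.assoc, Iso.hom_inv_id_assoc, reassoc_of% hc 0 1, Iso.hom_inv_id,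
        Category.comp_id]
    rw [h₀]
    constructor
    · rintro ⟨k, rfl⟩
      exact ⟨(e 1).inv ≫ k, by simp⟩
    · rintro ⟨k, hk⟩
      refine ⟨(e 1).hom ≫ k, ?_⟩
      simp [hk]
  · have h₁ : W.K.d n (n + 1) = (e n).hom ≫ X.dLast ≫ X.lst.inv ≫ (e (n + 1)).inv := by
      rw [Cpx.dLast, Category.assoc, Iso.hom_inv_id_assoc, reassoc_of% hc n (n + 1),
        Iso.hom_inv_id, Category.comp_id]
    rw [h₁]
    constructor
    · rintro ⟨k, rfl⟩
      exact ⟨k ≫ (e n).hom, by simp⟩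
    · rintro ⟨k, hk⟩
      refine ⟨k ≫ (e n).inv, ?_⟩
      simp [reassoc_of% hk]

/-! ### Weak kernels -/

/-- Projectives lift along deflations, hence so does every morphism through a projective. This is
the hypothesis `hker` for the contravariant defect. -/
lemma exists_factor_of_idealProj_map_eq_zero {Z A : C} {X : Cpx n A Z} {δ : Ext S.E Z A}
    (h : Realizes S.s X δ) {T : C} (t : T ⟶ Z) (ht : (idealProj S.proj).map t = 0) :
    ∃ g, g ≫ X.dLast = t := by
  obtain ⟨Q, hQ, a, b, rfl⟩ := (idealProj_map_eq_zero_iff _ _).1 ht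
  obtain ⟨c, rfl⟩ := hQ X δ h b
  exact ⟨a ≫ c, Category.assoc _ _ _⟩

lemma exists_cofactor_of_idealProj_map_eq_zero {Z A : C} {X : Cpx n A Z} {δ : Ext S.E Z A}
    (h : Realizes S.s X δ) {T : C} (t : A ⟶ T) (ht : (idealProj S.inj).map t = 0) :
    ∃ g, X.dFirst ≫ g = t := by
  obtain ⟨Q, hQ, a, b, rfl⟩ := (idealProj_map_eq_zero_iff _ _).1 ht
  obtain ⟨c, rfl⟩ := hQ X δ h a
  exact ⟨c ≫ b, (Category.assoc _ _ _).symm⟩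

lemma HasEnoughProj.exists_realizes (hn : 0 < n) (hP : S.HasEnoughProj) (Z : C) :
    ∃ (A : C) (X : Cpx n A Z) (δ : Ext S.E Z A), Realizes S.s X δ ∧ S.proj (X.K.X n) ∧
      (idealProj S.proj).map X.dLast = 0 := by
  obtain ⟨A, X, δ, h, hX⟩ := hP Z
  exact ⟨A, X, δ, h, hX n hn le_rfl,
    (idealProj_map_eq_zero_iff _ _).2 ⟨_, hX n hn le_rfl, 𝟙 _, _, (Category.id_comp _).symm⟩⟩

lemma HasEnoughInj.exists_realizes (hn : 0 < n) (hI : S.HasEnoughInj) (A : C) :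
    ∃ (Z : C) (X : Cpx n A Z) (δ : Ext S.E Z A), Realizes S.s X δ ∧ S.inj (X.K.X 1) ∧
      (idealProj S.inj).map X.dFirst = 0 := by
  obtain ⟨Z, X, δ, h, hX⟩ := hI A
  exact ⟨Z, X, δ, h, hX 1 le_rfl hn,
    (idealProj_map_eq_zero_iff _ _).2 ⟨_, hX 1 le_rfl hn, _, 𝟙 _, (Category.comp_id _).symm⟩⟩

/-- Let `δ` end in `Y` with projective middle terms. Then `t ≫ f` vanishes in `C/[P]` iff it lifts
to the last middle term, iff `t^* (f^* δ) = 0`, iff `t` factors through the last differential of a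
realization of `f^* δ`; that differential is the weak kernel. -/
lemma weakKernels_modProj (hn : 0 < n) (hP : S.HasEnoughProj) : WeakKernels S.ModProj := by
  intro X Y f
  obtain ⟨f, rfl⟩ := (idealProj S.proj).map_surjective (X := X.as) (Y := Y.as) f
  obtain ⟨A, P, δ, hδ, -, hzero⟩ := hP.exists_realizes hn Y.as
  obtain ⟨V, hV⟩ := S.exists_realizes (pull S.E f δ)
  refine ⟨(idealProj S.proj).obj (V.K.X n), (idealProj S.proj).map V.dLast, fun T t => ?_⟩
  obtain ⟨t, rfl⟩ := (idealProj S.proj).map_surjective (X := T.as) (Y := X.as) t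
  constructor
  · intro ht
    rw [← Functor.map_comp] at ht
    obtain ⟨g, hg⟩ := (pull_eq_zero_iff hV t).1 (by
      rw [← pull_comp, pull_eq_zero_iff hδ]
      exact exists_factor_of_idealProj_map_eq_zero hδ _ ht)
    exact ⟨(idealProj S.proj).map g, by rw [← hg, Functor.map_comp]⟩
  · rintro ⟨k, hk⟩
    obtain ⟨g, hg⟩ := (pull_eq_zero_iff hδ (V.dLast ≫ f)).1 (by
      rw [pull_comp, (S.isExangle V _ hV).pull_dLast])
    rw [← hk, Category.assoc, ← Functor.map_comp, ← hg, Functor.map_comp, hzero, comp_zero,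
      comp_zero]

lemma weakKernels_modInj_op (hn : 0 < n) (hI : S.HasEnoughInj) : WeakKernels S.ModInjᵒᵖ := by
  intro X Y φ
  obtain ⟨f, hf⟩ := (idealProj S.inj).map_surjective (X := Y.unop.as) (Y := X.unop.as) φ.unop
  obtain rfl : ((idealProj S.inj).map f).op = φ := congrArg Quiver.Hom.op hf
  obtain ⟨A, P, δ, hδ, -, hzero⟩ := hI.exists_realizes hn Y.unop.as
  obtain ⟨V, hV⟩ := S.exists_realizes (push S.E f δ)
  refine ⟨op ((idealProj S.inj).obj (V.K.X 1)), ((idealProj S.inj).map V.dFirst).op,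
    fun T τ => ?_⟩
  obtain ⟨t, ht⟩ := (idealProj S.inj).map_surjective (X := X.unop.as) (Y := T.unop.as) τ.unop
  obtain rfl : ((idealProj S.inj).map t).op = τ := congrArg Quiver.Hom.op ht
  constructor
  · intro ht
    have ht := congrArg Quiver.Hom.unop ht
    change (idealProj S.inj).map f ≫ (idealProj S.inj).map t = 0 at ht
    rw [← Functor.map_comp] at ht
    obtain ⟨g, hg⟩ := (push_eq_zero_iff hV t).1 (by
      rw [← push_comp, push_eq_zero_iff hδ]
      exact exists_cofactor_of_idealProj_map_eq_zero hδ _ ht)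
    exact ⟨((idealProj S.inj).map g).op, by rw [← op_comp, ← Functor.map_comp, hg]⟩
  · rintro ⟨k, hk⟩
    obtain ⟨g, hg⟩ := (push_eq_zero_iff hδ (f ≫ V.dFirst)).1 (by
      rw [push_comp, (S.isExangle V _ hV).push_dFirst])
    rw [← hk, Category.assoc, ← op_comp, ← Functor.map_comp, ← hg, Functor.map_comp, hzero,
      zero_comp, op_zero, comp_zero]

end ExangulatedStructure

namespace ExangulatedStructure

variable {n : ℕ} {C : Type u} [Category.{v} C] [Preadditive C] [HasZeroObject C]
  [HasBinaryBiproducts C] (S : ExangulatedStructure n C)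

/-! ### The contravariant defect -/

/-- The functor sending an `n`-exangle to its last differential. -/
def lastArrow : S.Exangle ⥤ Arrow C where
  obj W := Arrow.mk (W.K.d n (n + 1))
  map φ := Arrow.homMk (φ.hom.f n) (φ.hom.f (n + 1)) (φ.hom.comm n (n + 1))

/-- The contravariant defect with values in `mod-(C/[P])`. -/
noncomputable abbrev contraFunctor : S.Exangle ⥤ FPMod S.ModProj :=
  presFunctor (idealProj S.proj) S.lastArrow

/-- The functor sending an `n`-exangle to its first differential, as a morphism of `Cᵒᵖ`. -/
def firstArrow : S.Exangleᵒᵖ ⥤ Arrow Cᵒᵖ where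
  obj W := Arrow.mk (W.unop.K.d 0 1).op
  map φ := Arrow.homMk (φ.unop.hom.f 1).op (φ.unop.hom.f 0).op
    (congrArg Quiver.Hom.op (φ.unop.hom.comm 0 1)).symm

/-- The covariant defect with values in `mod-(C/[I])ᵒᵖ`. -/
noncomputable abbrev coFunctor : S.Exangleᵒᵖ ⥤ FPMod S.ModInjᵒᵖ :=
  presFunctor (idealProj S.inj).op S.firstArrow

/-! ### Lifting of morphisms, density and the kernel ideal for both defects -/

variable {S}

lemma Exangle.exists_factor (W : S.Exangle) {T : C} (g : T ⟶ W.K.X (n + 1))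
    (hg : (idealProj S.proj).map g = 0) : ∃ h, h ≫ W.K.d n (n + 1) = g := by
  have := exists_factor_of_idealProj_map_eq_zero W.realizes g hg
  rwa [W.dLast_cpx] at this

lemma Exangle.exists_cofactor (W : S.Exangle) {T : C} (g : W.K.X 0 ⟶ T)
    (hg : (idealProj S.inj).map g = 0) : ∃ h, W.K.d 0 1 ≫ h = g := by
  have := exists_cofactor_of_idealProj_map_eq_zero W.realizes g hg
  rwa [W.dFirst_cpx] at this

lemma lastArrow_factors (W : S.Exangle) {T : C} (g : T ⟶ (S.lastArrow.obj W).right)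
    (hg : (idealProj S.proj).map g = 0) : ∃ h, h ≫ (S.lastArrow.obj W).hom = g :=
  W.exists_factor g hg

lemma firstArrow_factors (W : S.Exangleᵒᵖ) {T : Cᵒᵖ} (g : T ⟶ (S.firstArrow.obj W).right)
    (hg : (idealProj S.inj).op.map g = 0) : ∃ h, h ≫ (S.firstArrow.obj W).hom = g := by
  obtain ⟨k, hk⟩ := W.unop.exists_cofactor g.unop (congrArg Quiver.Hom.unop hg)
  exact ⟨k.op, congrArg Quiver.Hom.op hk⟩

/-- A morphism of extensions lifts to a morphism of `n`-exangles. -/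
lemma Exangle.exists_hom {V W : S.Exangle} (a : V.K.X 0 ⟶ W.K.X 0)
    (c : V.K.X (n + 1) ⟶ W.K.X (n + 1)) (h : push S.E a V.δ = pull S.E c W.δ) :
    ∃ φ : V ⟶ W, φ.hom.f 0 = a ∧ φ.hom.f (n + 1) = c := by
  obtain ⟨f, hf⟩ := S.exists_lift V.δ W.δ V.cpx W.cpx a c V.realizes W.realizes h
  have h₀ : f.f 0 = a := by simpa using hf.fst
  have h₁ : f.f (n + 1) = c := by simpa using hf.lst
  exact ⟨⟨f, by rw [h₀, h₁, h]⟩, h₀, h₁⟩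

/-- The square shows that `c^* W.δ` dies on `V.K.X n`, so it is a pushout `a_* V.δ`, and (R0) lifts
`(a, c)`. The resulting morphism need not extend `l`. -/
lemma Exangle.exists_hom_of_last (hn : 0 < n) {V W : S.Exangle}
    (c : V.K.X (n + 1) ⟶ W.K.X (n + 1)) (l : V.K.X n ⟶ W.K.X n)
    (hl : l ≫ W.K.d n (n + 1) = V.K.d n (n + 1) ≫ c) : ∃ φ : V ⟶ W, φ.hom.f (n + 1) = c := by
  obtain ⟨a, ha⟩ := exists_push hn V.realizes (pull S.E c W.δ) (by
    rw [← pull_comp, V.dLast_cpx, W.pull_eq_zero_iff]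
    exact ⟨l, hl⟩)
  obtain ⟨φ, -, hφ⟩ := Exangle.exists_hom a c ha
  exact ⟨φ, hφ⟩

lemma Exangle.exists_hom_of_first (hn : 0 < n) {V W : S.Exangle}
    (a : V.K.X 0 ⟶ W.K.X 0) (l : V.K.X 1 ⟶ W.K.X 1)
    (hl : V.K.d 0 1 ≫ l = a ≫ W.K.d 0 1) : ∃ φ : V ⟶ W, φ.hom.f 0 = a := by
  obtain ⟨c, hc⟩ := exists_pull hn W.realizes (push S.E a V.δ) (by
    rw [← push_comp, W.dFirst_cpx, V.push_eq_zero_iff]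
    exact ⟨l, hl⟩)
  obtain ⟨φ, hφ, -⟩ := Exangle.exists_hom a c hc.symm
  exact ⟨φ, hφ⟩

lemma lastArrow_lift (hn : 0 < n) (V W : S.Exangle)
    (c : (S.lastArrow.obj V).right ⟶ (S.lastArrow.obj W).right)
    (h : ∃ l, l ≫ (S.lastArrow.obj W).hom = (S.lastArrow.obj V).hom ≫ c) :
    ∃ φ : V ⟶ W, (S.lastArrow.map φ).right = c := by
  obtain ⟨l, hl⟩ := h
  exact Exangle.exists_hom_of_last hn c l hl

lemma firstArrow_lift (hn : 0 < n) (V W : S.Exangleᵒᵖ)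
    (c : (S.firstArrow.obj V).right ⟶ (S.firstArrow.obj W).right)
    (h : ∃ l, l ≫ (S.firstArrow.obj W).hom = (S.firstArrow.obj V).hom ≫ c) :
    ∃ φ : V ⟶ W, (S.firstArrow.map φ).right = c := by
  obtain ⟨l, hl⟩ := h
  obtain ⟨φ, hφ⟩ := Exangle.exists_hom_of_first hn c.unop l.unop (congrArg Quiver.Hom.unop hl)
  exact ⟨φ.op, congrArg Quiver.Hom.op hφ⟩

/-- The exangle is the mapping cone with last differential `(f, p)`, where `p` starts at a
projective. So `p` is zero in `C/[P]`, and only `f` remains. -/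
lemma lastArrow_presents (hn : 0 < n) (hP : S.HasEnoughProj) {A B : S.ModProj} (f : A ⟶ B) :
    ∃ (W : S.Exangle) (e : (idealProj S.proj).obj (S.lastArrow.obj W).right ≅ B),
      ∀ {T : S.ModProj} (t : T ⟶ (idealProj S.proj).obj (S.lastArrow.obj W).right),
        (∃ k, k ≫ (idealProj S.proj).map (S.lastArrow.obj W).hom = t) ↔
          ∃ k, k ≫ f = t ≫ e.hom := by
  obtain ⟨f, rfl⟩ := (idealProj S.proj).map_surjective (X := A.as) (Y := B.as) f
  obtain ⟨A', P, δ, hδ, -, hzero⟩ := hP.exists_realizes hn B.as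
  obtain ⟨X, hX⟩ := S.exists_realizes (pull S.E f δ)
  obtain ⟨g, hg, N, hN⟩ := S.good_lift δ f X P hX hδ
  obtain ⟨W, -, e, -, hW⟩ := exists_exangle hN
  refine ⟨W, (idealProj S.proj).mapIso e, fun {T} t => ?_⟩
  obtain ⟨t, rfl⟩ := (idealProj S.proj).map_surjective (X := T.as) (Y := W.K.X (n + 1)) t
  have key : (∃ k, k ≫ W.K.d n (n + 1) = t) ↔ ∃ u v, u ≫ f + v ≫ P.dLast = t ≫ e.hom :=
    (hW t).trans (N.factors_dLast_iff hn hg _)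
  constructor
  · rintro ⟨k, hk⟩
    obtain ⟨k, rfl⟩ := (idealProj S.proj).map_surjective (X := T.as) (Y := W.K.X n) k
    have hk : (idealProj S.proj).map k ≫ (idealProj S.proj).map (W.K.d n (n + 1)) =
      (idealProj S.proj).map t := hk
    obtain ⟨l, hl⟩ := W.exists_factor (t - k ≫ W.K.d n (n + 1))
      (by rw [Functor.map_sub, Functor.map_comp, hk, sub_self])
    obtain ⟨u, v, huv⟩ := key.1 ⟨k + l, by rw [Preadditive.add_comp, hl, add_sub_cancel]⟩
    refine ⟨(idealProj S.proj).map u, ?_⟩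
    have := congrArg (idealProj S.proj).map huv
    rw [Functor.map_add, Functor.map_comp, Functor.map_comp, hzero, comp_zero, add_zero,
      Functor.map_comp] at this
    exact this
  · rintro ⟨k, hk⟩
    obtain ⟨k, rfl⟩ := (idealProj S.proj).map_surjective (X := T.as) (Y := A.as) k
    -- A factorization through `f` modulo projectives is exact up to a term through `P.dLast`, which
    -- is the second component of the cone differential.
    obtain ⟨l, hl⟩ := exists_factor_of_idealProj_map_eq_zero hδ (t ≫ e.hom - k ≫ f)
      (by rw [Functor.map_sub, Functor.map_comp, Functor.map_comp]; exact sub_eq_zero.2 hk.symm)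
    obtain ⟨w, hw⟩ := key.2 ⟨k, l, by rw [hl, add_sub_cancel]⟩
    exact ⟨(idealProj S.proj).map w, by rw [← hw, Functor.map_comp]; rfl⟩

lemma firstArrow_presents (hn : 0 < n) (hI : S.HasEnoughInj) {A B : S.ModInjᵒᵖ} (φ : A ⟶ B) :
    ∃ (W : S.Exangleᵒᵖ) (e : (idealProj S.inj).op.obj (S.firstArrow.obj W).right ≅ B),
      ∀ {T : S.ModInjᵒᵖ} (t : T ⟶ (idealProj S.inj).op.obj (S.firstArrow.obj W).right),
        (∃ k, k ≫ (idealProj S.inj).op.map (S.firstArrow.obj W).hom = t) ↔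
          ∃ k, k ≫ φ = t ≫ e.hom := by
  obtain ⟨f, hf⟩ := (idealProj S.inj).map_surjective (X := B.unop.as) (Y := A.unop.as) φ.unop
  obtain rfl : ((idealProj S.inj).map f).op = φ := congrArg Quiver.Hom.op hf
  obtain ⟨A', I, δ, hδ, -, hzero⟩ := hI.exists_realizes hn B.unop.as
  obtain ⟨X, hX⟩ := S.exists_realizes (push S.E f δ)
  obtain ⟨g, hg, N, hN⟩ := S.good_lift_op δ f I X hδ hX
  obtain ⟨W, e, -, hW, -⟩ := exists_exangle hN
  refine ⟨op W, ((idealProj S.inj).mapIso e).op, fun {T} τ => ?_⟩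
  obtain ⟨t, ht⟩ := (idealProj S.inj).map_surjective (X := W.K.X 0) (Y := T.unop.as) τ.unop
  obtain rfl : ((idealProj S.inj).map t).op = τ := congrArg Quiver.Hom.op ht
  have key : (∃ k, W.K.d 0 1 ≫ k = t) ↔ ∃ u v, I.dFirst ≫ u + f ≫ v = e.hom ≫ t :=
    (hW t).trans (N.factors_dFirst_iff hn hg _)
  constructor
  · rintro ⟨κ, hk⟩
    obtain ⟨k, hκ⟩ := (idealProj S.inj).map_surjective (X := W.K.X 1) (Y := T.unop.as) κ.unop
    obtain rfl : ((idealProj S.inj).map k).op = κ := congrArg Quiver.Hom.op hκ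
    have hk : (idealProj S.inj).map (W.K.d 0 1) ≫ (idealProj S.inj).map k =
      (idealProj S.inj).map t := congrArg Quiver.Hom.unop hk
    obtain ⟨l, hl⟩ := W.exists_cofactor (t - W.K.d 0 1 ≫ k)
      (by rw [Functor.map_sub, Functor.map_comp, hk, sub_self])
    obtain ⟨u, v, huv⟩ := key.1 ⟨k + l, by rw [Preadditive.comp_add, hl, add_sub_cancel]⟩
    refine ⟨((idealProj S.inj).map v).op, Quiver.Hom.unop_inj ?_⟩
    have := congrArg (idealProj S.inj).map huv
    rw [Functor.map_add, Functor.map_comp, Functor.map_comp, hzero, zero_comp, zero_add,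
      Functor.map_comp] at this
    exact this
  · rintro ⟨κ, hk⟩
    obtain ⟨k, hκ⟩ := (idealProj S.inj).map_surjective (X := A.unop.as) (Y := T.unop.as) κ.unop
    obtain rfl : ((idealProj S.inj).map k).op = κ := congrArg Quiver.Hom.op hκ
    have hk : (idealProj S.inj).map f ≫ (idealProj S.inj).map k =
      (idealProj S.inj).map e.hom ≫ (idealProj S.inj).map t := congrArg Quiver.Hom.unop hk
    obtain ⟨l, hl⟩ := exists_cofactor_of_idealProj_map_eq_zero hδ (e.hom ≫ t - f ≫ k)
      (by rw [Functor.map_sub, Functor.map_comp, Functor.map_comp, hk, sub_self])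
    obtain ⟨w, hw⟩ := key.2 ⟨l, k, by rw [hl, sub_add_cancel]⟩
    exact ⟨((idealProj S.inj).map w).op, Quiver.Hom.unop_inj (by
      rw [← hw, Functor.map_comp]; rfl)⟩

lemma relR₂_iff_contraFunctor {V W : S.Exangle} (φ ψ : V ⟶ W) :
    S.relR₂ φ ψ ↔ S.contraFunctor.map φ = S.contraFunctor.map ψ := by
  rw [presFunctor_map_eq_iff _ _ fun W _ g hg => lastArrow_factors W g hg]
  exact ⟨fun ⟨g, hg⟩ => ⟨g, hg.symm⟩, fun ⟨g, hg⟩ => ⟨g, hg.symm⟩⟩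

/-- The difference of last components factors through the last differential of `W` iff it kills
`W.δ`. By compatibility this says that the difference of first components kills `V.δ`, i.e. factors
through the first differential of `V`. -/
lemma relR₂_iff_coFunctor {V W : S.Exangle} (φ ψ : V ⟶ W) :
    S.relR₂ φ ψ ↔ S.coFunctor.rightOp.map φ = S.coFunctor.rightOp.map ψ := by
  have h : S.coFunctor.rightOp.map φ = S.coFunctor.rightOp.map ψ ↔
      S.coFunctor.map φ.op = S.coFunctor.map ψ.op :=
    ⟨fun h => congrArg Quiver.Hom.unop h, fun h => congrArg Quiver.Hom.op h⟩
  rw [h, presFunctor_map_eq_iff _ _ fun W _ g hg => firstArrow_factors W g hg]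
  have h₁ : S.relR₂ φ ψ ↔ pull S.E (φ.hom.f (n + 1) - ψ.hom.f (n + 1)) W.δ = 0 := by
    rw [W.pull_eq_zero_iff]
    exact ⟨fun ⟨g, hg⟩ => ⟨g, hg.symm⟩, fun ⟨g, hg⟩ => ⟨g, hg.symm⟩⟩
  rw [h₁, pull_sub, ← φ.compat, ← ψ.compat, ← push_sub, V.push_eq_zero_iff]
  exact ⟨fun ⟨g, hg⟩ => ⟨g.op, congrArg Quiver.Hom.op hg⟩,
    fun ⟨g, hg⟩ => ⟨g.unop, congrArg Quiver.Hom.unop hg⟩⟩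

end ExangulatedStructure

/-! ### Restriction along full and essentially surjective functors -/

section Whiskering

variable {A : Type u₁} [Category.{v₁} A] {B : Type u₂} [Category.{v₂} B] (P : A ⥤ B) [P.EssSurj]
  (E : Type u₃) [Category.{v₃} E]

lemma faithful_whiskeringLeft : ((Functor.whiskeringLeft A B E).obj P).Faithful where
  map_injective {F G} φ ψ h := by
    ext X
    rw [← cancel_epi (F.map (P.objObjPreimageIso X).hom), φ.naturality, ψ.naturality]
    exact congrArg (· ≫ G.map (P.objObjPreimageIso X).hom)
      (congrArg (fun t : P ⋙ F ⟶ P ⋙ G => t.app (P.objPreimage X)) h)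

lemma full_whiskeringLeft [P.Full] : ((Functor.whiskeringLeft A B E).obj P).Full where
  map_surjective {F G} ψ := by
    change P ⋙ F ⟶ P ⋙ G at ψ
    -- Fullness of `P` upgrades naturality to all morphisms between objects in the image;
    -- conjugating by preimage isomorphisms then extends `ψ` to all of `B`.
    have hψ : ∀ {X Y : A} (f : P.obj X ⟶ P.obj Y),
        F.map f ≫ ψ.app Y = ψ.app X ≫ G.map f := fun {X Y} f => by
      obtain ⟨f, rfl⟩ := P.map_surjective f
      exact ψ.naturality f
    let φ : F ⟶ G :=
      { app := fun X => F.map (P.objObjPreimageIso X).inv ≫ ψ.app (P.objPreimage X) ≫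
          G.map (P.objObjPreimageIso X).hom
        naturality := fun X Y f => by
          rw [← cancel_epi (F.map (P.objObjPreimageIso X).hom),
            ← cancel_mono (G.map (P.objObjPreimageIso Y).inv)]
          have := hψ ((P.objObjPreimageIso X).hom ≫ f ≫ (P.objObjPreimageIso Y).inv)
          simp only [Functor.map_comp, Category.assoc] at this
          simp only [Category.assoc, Iso.map_hom_inv_id_assoc, Iso.map_hom_inv_id]
          erw [Category.comp_id]
          exact this }
    refine ⟨φ, ?_⟩
    ext X
    have := hψ (P.objObjPreimageIso (P.obj X)).inv
    change F.map _ ≫ ψ.app _ ≫ G.map _ = ψ.app X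
    rw [reassoc_of% this, ← G.map_comp, Iso.inv_hom_id, G.map_id]
    exact Category.comp_id _

end Whiskering

section Restrict

variable {C : Type u} [Category.{v} C] [Preadditive C] [HasBinaryBiproducts C]
  (W : ObjectProperty C) [IsSumClosed W]

instance : (restrict W).Faithful :=
  have := faithful_whiskeringLeft (idealProj W).op AddCommGrpCat.{v}
  inferInstanceAs ((isFinPres _).ι ⋙ _).Faithful

instance : (restrict W).Full :=
  have := full_whiskeringLeft (idealProj W).op AddCommGrpCat.{v}
  inferInstanceAs ((isFinPres _).ι ⋙ _).Full

instance : (restrictOp W).Faithful :=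
  have := faithful_whiskeringLeft (idealProj W ⋙ opOp _) AddCommGrpCat.{v}
  inferInstanceAs ((isFinPres _).ι ⋙ _).Faithful

instance : (restrictOp W).Full :=
  have := full_whiskeringLeft (idealProj W ⋙ opOp _) AddCommGrpCat.{v}
  inferInstanceAs ((isFinPres _).ι ⋙ _).Full

end Restrict

/-! ### Injective objects through a duality -/

section Duality

variable {𝒜 : Type u₁} [Category.{v₁} 𝒜] {ℬ : Type u₂} [Category.{v₂} ℬ]

/-- Used for the fully faithful restriction functors: `𝔼(-,A)` is a functor on `C`, so being a
summand of it is tested after restriction. -/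
lemma nonempty_retract_map_iff (F : 𝒜 ⥤ ℬ) [F.Full] [F.Faithful] {X Y : 𝒜} {Z : ℬ}
    (e : F.obj Y ≅ Z) : Nonempty (Retract X Y) ↔ Nonempty (Retract (F.obj X) Z) := by
  refine ⟨fun ⟨r⟩ => ⟨(r.map F).trans (Retract.ofIso e)⟩, fun ⟨r⟩ => ?_⟩
  exact ⟨{ i := F.preimage (r.i ≫ e.inv)
           r := F.preimage (e.hom ≫ r.r)
           retract := F.map_injective (by simp) }⟩

lemma nonempty_iso_map_iff (F : 𝒜 ⥤ ℬ) [F.Full] [F.Faithful] {X Y : 𝒜} {Z : ℬ}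
    (e : F.obj Y ≅ Z) : Nonempty (X ≅ Y) ↔ Nonempty (F.obj X ≅ Z) :=
  ⟨fun ⟨r⟩ => ⟨F.mapIso r ≪≫ e⟩, fun ⟨r⟩ => ⟨F.preimageIso (r ≪≫ e.symm)⟩⟩

lemma nonempty_retract_unop_iff {X : ℬᵒᵖ} {Y : ℬ} :
    Nonempty (Retract X.unop Y) ↔ Nonempty (Retract X (op Y)) :=
  ⟨fun ⟨r⟩ => ⟨{ i := r.r.op, r := r.i.op, retract := congrArg Quiver.Hom.op r.retract }⟩,
    fun ⟨r⟩ => ⟨{ i := r.r.unop, r := r.i.unop, retract := congrArg Quiver.Hom.unop r.retract }⟩⟩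

lemma nonempty_iso_unop_iff {X : ℬᵒᵖ} {Y : ℬ} :
    Nonempty (X.unop ≅ Y) ↔ Nonempty (X ≅ op Y) :=
  ⟨fun ⟨r⟩ => ⟨r.symm.op⟩, fun ⟨r⟩ => ⟨r.symm.unop⟩⟩

variable (e : 𝒜 ≌ ℬᵒᵖ)
include e

lemma injective_iff_projective_of_duality (M : 𝒜) :
    Injective M ↔ Projective (e.functor.obj M).unop := by
  rw [← e.map_injective_iff, Injective.projective_iff_injective_op]

lemma enoughInjectives_of_duality [EnoughProjectives ℬ] : EnoughInjectives 𝒜 :=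
  e.enoughInjectives_iff.2 inferInstance

variable {ι : Type*} {N : ι → 𝒜} {R : ι → ℬ} (hNR : ∀ A, Nonempty (e.functor.obj (N A) ≅ op (R A)))
include hNR

lemma injective_iff_retract_of_duality
    (hR : ∀ M : ℬ, Projective M ↔ ∃ A, Nonempty (Retract M (R A))) (M : 𝒜) :
    Injective M ↔ ∃ A, Nonempty (Retract M (N A)) := by
  rw [injective_iff_projective_of_duality e, hR]
  refine exists_congr fun A => ?_
  rw [nonempty_retract_unop_iff, ← nonempty_retract_map_iff e.functor (hNR A).some]

lemma injective_iff_iso_of_duality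
    (hR : ∀ M : ℬ, Projective M ↔ ∃ A, Nonempty (M ≅ R A)) (M : 𝒜) :
    Injective M ↔ ∃ A, Nonempty (M ≅ N A) := by
  rw [injective_iff_projective_of_duality e, hR]
  refine exists_congr fun A => ?_
  rw [nonempty_iso_unop_iff, ← nonempty_iso_map_iff e.functor (hNR A).some]

end Duality

/-! ### Coyoneda and the opposite category -/

section Coyoneda

variable (C : Type u) [Category.{v} C] [Preadditive C]

/-- The covariant representable functors of `C` are the contravariant ones of `Cᵒᵖ`. -/
def coyonedaIso : (preadditiveCoyoneda : Cᵒᵖ ⥤ C ⥤ AddCommGrpCat.{v}) ≅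
    preadditiveYoneda ⋙ (Functor.whiskeringLeft _ _ _).obj (opOp C) :=
  NatIso.ofComponents (fun X => NatIso.ofComponents (fun T => AddEquiv.toAddCommGrpIso
      { toFun := fun g : X.unop ⟶ T => (g.op : op T ⟶ X)
        invFun := fun g => g.unop
        left_inv := fun _ => rfl
        right_inv := fun _ => rfl
        map_add' := fun _ _ => rfl }) fun _ => rfl) fun _ => rfl

variable {C}

/-- The cokernel of a map of covariant representable functors. -/
noncomputable def cokernelCoyonedaIso (f : Arrow Cᵒᵖ) :
    cokernel (preadditiveCoyoneda.map f.hom) ≅ opOp C ⋙ (cokerYoneda Cᵒᵖ).obj f :=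
  cokernel.mapIso (preadditiveCoyoneda.map f.hom)
    (((Functor.whiskeringLeft _ _ _).obj (opOp C)).map (preadditiveYoneda.map f.hom))
    ((coyonedaIso C).app f.left) ((coyonedaIso C).app f.right)
    ((coyonedaIso C).hom.naturality f.hom) ≪≫
  (PreservesCokernel.iso ((Functor.whiskeringLeft _ _ _).obj (opOp C))
    (preadditiveYoneda.map f.hom)).symm

lemma π_cokernelCoyonedaIso_hom (f : Arrow Cᵒᵖ) :
    cokernel.π (preadditiveCoyoneda.map f.hom) ≫ (cokernelCoyonedaIso f).hom =
      (coyonedaIso C).hom.app f.right ≫ Functor.whiskerLeft (opOp C) (cokerProj f) := by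
  have h := PreservesCokernel.π_iso_hom ((Functor.whiskeringLeft _ _ AddCommGrpCat.{v}).obj (opOp C))
    (preadditiveYoneda.map f.hom)
  rw [← Iso.eq_comp_inv] at h
  refine (cokernel.π_desc_assoc _ _ _ _).trans ?_
  exact (Category.assoc _ _ _).trans (congrArg ((coyonedaIso C).hom.app f.right ≫ ·) h.symm)

end Coyoneda

lemma nonempty_cokerFP_iso_repr {D : Type u} [Category.{v} D] [Preadditive D] {f : Arrow D} {Y : D}
    (hf : f.hom = 0) (e : f.right ≅ Y) : Nonempty ((cokerFP D).obj f ≅ FPMod.repr Y) := by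
  refine nonempty_cokerFP_iso (M := FPMod.repr Y) (isPres_yoneda Y) e fun {T} t => ?_
  rw [hf]
  constructor
  · rintro ⟨k, rfl⟩
    exact ⟨0, by simp⟩
  · rintro ⟨k, hk⟩
    exact ⟨0, by simpa [eq_comm, ← cancel_mono e.hom] using hk⟩

namespace ExangulatedStructure

variable {n : ℕ} {C : Type u} [Category.{v} C] [Preadditive C] [HasZeroObject C]
  [HasBinaryBiproducts C] (S : ExangulatedStructure n C)

/-! ### The defects as functors on `C` -/

lemma nonempty_contraFunctor_restrict_iso :
    Nonempty (S.contraFunctor ⋙ restrict S.proj ≅ S.contraDefect) := by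
  obtain ⟨e⟩ := nonempty_presFunctor_restrict_iso (idealProj S.proj) S.lastArrow
    fun W _ g hg => lastArrow_factors W g hg
  exact ⟨e ≪≫ NatIso.ofComponents (fun _ => Iso.refl _) fun f =>
    (Category.comp_id _).trans (Category.id_comp _).symm⟩

/-- The covariant defect as the restriction of a contravariant cokernel over `Cᵒᵖ`. -/
noncomputable def coDefectIso :
    S.coDefect.leftOp ≅
      S.firstArrow ⋙ cokerYoneda Cᵒᵖ ⋙ (Functor.whiskeringLeft _ _ _).obj (opOp C) :=
  NatIso.ofComponents (fun W => cokernelCoyonedaIso (S.firstArrow.obj W)) fun {V W} f => by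
    apply coequalizer.hom_ext
    have h₂ := π_cokernelCoyonedaIso_hom (S.firstArrow.obj V)
    have h₃ := π_cokernelCoyonedaIso_hom (S.firstArrow.obj W)
    have h₄ := cokerProj_naturality (S.firstArrow.map f)
    have h₅ := (coyonedaIso C).hom.naturality (S.firstArrow.map f).right
    have h₆ : cokernel.π (preadditiveCoyoneda.map (S.firstArrow.obj V).hom) ≫
        S.coDefect.leftOp.map f = preadditiveCoyoneda.map (S.firstArrow.map f).right ≫
          cokernel.π (preadditiveCoyoneda.map (S.firstArrow.obj W).hom) :=
      cokernel.π_desc _ _ _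
    refine ((Category.assoc _ _ _).symm.trans (congrArg
      (· ≫ (cokernelCoyonedaIso (S.firstArrow.obj W)).hom) h₆)).trans ?_
    refine ((Category.assoc _ _ _).trans (congrArg
      (preadditiveCoyoneda.map (S.firstArrow.map f).right ≫ ·) h₃)).trans ?_
    refine Eq.trans ?_ ((Category.assoc _ _ _).symm.trans (congrArg
      (· ≫ Functor.whiskerLeft (opOp C) ((cokerYoneda Cᵒᵖ).map (S.firstArrow.map f))) h₂)).symm
    refine (Category.assoc _ _ _).symm.trans ((congrArg
      (· ≫ Functor.whiskerLeft (opOp C) (cokerProj (S.firstArrow.obj W))) h₅).trans ?_)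
    refine (Category.assoc _ _ _).trans (Eq.trans ?_ (Category.assoc _ _ _).symm)
    exact congrArg (fun t => (coyonedaIso C).hom.app (S.firstArrow.obj V).right ≫
      Functor.whiskerLeft (opOp C) t) h₄.symm

lemma nonempty_coFunctor_restrictOp_iso :
    Nonempty (S.coFunctor.rightOp ⋙ (restrictOp S.inj).op ≅ S.coDefect) := by
  obtain ⟨e⟩ := nonempty_presFunctor_restrict_iso (idealProj S.inj).op S.firstArrow
    fun W _ g hg => firstArrow_factors W g hg
  let α : S.coFunctor ⋙ restrictOp S.inj ≅ S.coDefect.leftOp :=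
    Functor.isoWhiskerRight e ((Functor.whiskeringLeft _ _ _).obj (opOp C)) ≪≫ S.coDefectIso.symm
  exact ⟨NatIso.ofComponents (fun X => (α.app (op X)).symm.op) fun f =>
    congrArg Quiver.Hom.op (α.inv.naturality f.op).symm⟩

/-! ### The equivalences -/

variable {S}

lemma exists_contraEquivalence (hn : 0 < n) (hP : S.HasEnoughProj) :
    ∃ F : S.ExangleQuotient ≌ FPMod S.ModProj,
      Nonempty (S.exangleProj ⋙ F.functor ≅ S.contraFunctor) := by
  have := presFunctor_full (idealProj S.proj) S.lastArrow
    (fun W _ g hg => lastArrow_factors W g hg) (lastArrow_lift hn)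
  have := presFunctor_essSurj (idealProj S.proj) S.lastArrow (lastArrow_presents hn hP)
  have H := fun (V W : S.Exangle) (φ ψ : V ⟶ W) => relR₂_iff_contraFunctor φ ψ
  have := quotient_lift_isEquivalence S.relR₂ S.contraFunctor H
  exact ⟨(CategoryTheory.Quotient.lift S.relR₂ S.contraFunctor
    fun V W φ ψ => (H V W φ ψ).1).asEquivalence,
    ⟨CategoryTheory.Quotient.lift.isLift _ _ fun V W φ ψ => (H V W φ ψ).1⟩⟩

lemma exists_coEquivalence (hn : 0 < n) (hI : S.HasEnoughInj) :
    ∃ G : S.ExangleQuotient ≌ (FPMod S.ModInjᵒᵖ)ᵒᵖ,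
      Nonempty (S.exangleProj ⋙ G.functor ≅ S.coFunctor.rightOp) := by
  have := presFunctor_full (idealProj S.inj).op S.firstArrow
    (fun W _ g hg => firstArrow_factors W g hg) (firstArrow_lift hn)
  have := presFunctor_essSurj (idealProj S.inj).op S.firstArrow (firstArrow_presents hn hI)
  have : S.coFunctor.rightOp.EssSurj :=
    ⟨fun Y => ⟨(S.coFunctor.objPreimage Y.unop).unop,
      ⟨(S.coFunctor.objObjPreimageIso Y.unop).symm.op⟩⟩⟩
  have H := fun (V W : S.Exangle) (φ ψ : V ⟶ W) => relR₂_iff_coFunctor φ ψ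
  have := quotient_lift_isEquivalence S.relR₂ S.coFunctor.rightOp H
  exact ⟨(CategoryTheory.Quotient.lift S.relR₂ S.coFunctor.rightOp
    fun V W φ ψ => (H V W φ ψ).1).asEquivalence,
    ⟨CategoryTheory.Quotient.lift.isLift _ _ fun V W φ ψ => (H V W φ ψ).1⟩⟩

/-- Going back along the first equivalence and forward along the second turns the contravariant
defect of an exangle into its covariant defect. -/
lemma exists_duality (hn : 0 < n) (hP : S.HasEnoughProj) (hI : S.HasEnoughInj) :
    ∃ e : FPMod S.ModProj ≌ (FPMod S.ModInjᵒᵖ)ᵒᵖ,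
      ∀ V, Nonempty (e.functor.obj (S.contraFunctor.obj V) ≅ op (S.coFunctor.obj (op V))) := by
  obtain ⟨F, ⟨f⟩⟩ := exists_contraEquivalence hn hP
  obtain ⟨G, ⟨g⟩⟩ := exists_coEquivalence hn hI
  exact ⟨F.symm.trans G, fun V => ⟨G.functor.mapIso
    (F.inverse.mapIso (f.symm.app V) ≪≫ (F.unitIso.symm.app (S.exangleProj.obj V))) ≪≫ g.app V⟩⟩

/-! ### Extension functors as defects -/

variable (S) in
lemma additive_flip_obj (A : C) : (S.E.flip.obj A).Additive :=
  have := S.additive_left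
  inferInstanceAs (S.E ⋙ (evaluation C AddCommGrpCat).obj A).Additive

/-- `𝔼(-,X₁) = 0`, so `C(-,Xₙ) ⟶ C(-,Z) ⟶ 𝔼(-,A) ⟶ 0` is exact, with `δ` as generator. -/
lemma isPres_contra_ext (hn : 0 < n) {Z A : C} {X : Cpx n A Z} {δ : Ext S.E Z A}
    (h : Realizes S.s X δ) (hX : S.inj (X.K.X 1)) : IsPres (S.E.flip.obj A) X.dLast δ where
  gen x := exists_pull hn h x (ext_eq_zero_of_inj hX _)
  rel c := pull_eq_zero_iff h c

lemma isPres_co_ext (hn : 0 < n) {Z A : C} {X : Cpx n A Z} {δ : Ext S.E Z A}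
    (h : Realizes S.s X δ) (hX : S.proj (X.K.X n)) :
    IsPres (unopUnop C ⋙ S.E.obj (op Z)) (X.dFirst.op : op (X.K.X 1) ⟶ op A) δ where
  gen {T} x := by
    obtain ⟨a, ha⟩ := exists_push hn h (T := T.unop) x (ext_eq_zero_of_proj hX _)
    exact ⟨a.op, ha⟩
  rel c := (push_eq_zero_iff h c.unop).trans
    ⟨fun ⟨g, hg⟩ => ⟨g.op, congrArg Quiver.Hom.op hg⟩,
      fun ⟨g, hg⟩ => ⟨g.unop, congrArg Quiver.Hom.unop hg⟩⟩

/-- The first differential ends in an injective and vanishes in `C/[I]`, so the covariant defect is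
representable, while the contravariant one is the extension functor. Under the duality this makes
`𝔼(-,A)` correspond to a projective. -/
lemma exists_injective_presentation (hn : 0 < n) (hI : S.HasEnoughInj) (A : C) :
    ∃ W : S.Exangle,
      Nonempty (S.coFunctor.obj (op W) ≅ FPMod.repr (op ((idealProj S.inj).obj A))) ∧
      Nonempty ((restrict S.proj).obj (S.contraFunctor.obj W) ≅ S.E.flip.obj A) := by
  obtain ⟨Z, X, δ, h, hX, hzero⟩ := hI.exists_realizes hn A
  obtain ⟨W, e₀, e₁, h₀, h₁⟩ := exists_exangle h
  have := S.additive_flip_obj A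
  refine ⟨W, ?_, ?_⟩
  · refine nonempty_cokerFP_iso_repr
      (f := (idealProj S.inj).op.mapArrow.obj (S.firstArrow.obj (op W)))
      ?_ ((idealProj S.inj).mapIso e₀).op
    have hW : (idealProj S.inj).map (W.K.d 0 1) = 0 := by
      obtain ⟨k, hk⟩ := (h₀ (W.K.d 0 1)).1 ⟨𝟙 _, Category.comp_id _⟩
      have := congrArg (idealProj S.inj).map hk
      rw [Functor.map_comp, hzero, zero_comp, Functor.map_comp] at this
      rw [← cancel_epi ((idealProj S.inj).map e₀.hom), comp_zero, ← this]
    exact congrArg Quiver.Hom.op hW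
  · obtain ⟨α⟩ := S.nonempty_contraFunctor_restrict_iso
    obtain ⟨β⟩ := nonempty_cokerYoneda_iso (f := S.lastArrow.obj W)
      (isPres_contra_ext hn h hX) e₁ h₁
    exact ⟨α.app W ≪≫ β⟩

lemma exists_projective_presentation (hn : 0 < n) (hP : S.HasEnoughProj) (A : C) :
    ∃ W : S.Exangle,
      Nonempty (S.contraFunctor.obj W ≅ FPMod.repr ((idealProj S.proj).obj A)) ∧
      Nonempty ((restrictOp S.inj).obj (S.coFunctor.obj (op W)) ≅ S.E.obj (op A)) := by
  obtain ⟨Z, X, δ, h, hX, hzero⟩ := hP.exists_realizes hn A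
  obtain ⟨W, e₀, e₁, h₀, h₁⟩ := exists_exangle h
  have := S.additive_right (op A)
  refine ⟨W, ?_, ?_⟩
  · refine nonempty_cokerFP_iso_repr
      (f := (idealProj S.proj).mapArrow.obj (S.lastArrow.obj W)) ?_ ((idealProj S.proj).mapIso e₁)
    have hW : (idealProj S.proj).map (W.K.d n (n + 1)) = 0 := by
      obtain ⟨k, hk⟩ := (h₁ (W.K.d n (n + 1))).1 ⟨𝟙 _, Category.id_comp _⟩
      have := congrArg (idealProj S.proj).map hk
      rw [Functor.map_comp, hzero, comp_zero, Functor.map_comp] at this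
      rw [← cancel_mono ((idealProj S.proj).map e₁.hom), zero_comp, ← this]
    exact hW
  · obtain ⟨e⟩ := nonempty_presFunctor_restrict_iso (idealProj S.inj).op S.firstArrow
      fun W _ g hg => firstArrow_factors W g hg
    have : (unopUnop C ⋙ S.E.obj (op A)).Additive :=
      { map_add := fun {_ _ f g} => (S.E.obj (op A)).map_add (f := f.unop.unop) (g := g.unop.unop) }
    obtain ⟨β⟩ := nonempty_cokerYoneda_iso (f := S.firstArrow.obj (op W))
      (isPres_co_ext hn h hX) e₀.op fun {T} t => by
        refine Iff.trans ?_ ((h₀ t.unop).trans ?_)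
        · exact ⟨fun ⟨k, hk⟩ => ⟨k.unop, congrArg Quiver.Hom.unop hk⟩,
            fun ⟨k, hk⟩ => ⟨k.op, congrArg Quiver.Hom.op hk⟩⟩
        · exact ⟨fun ⟨k, hk⟩ => ⟨k.op, congrArg Quiver.Hom.op hk⟩,
            fun ⟨k, hk⟩ => ⟨k.unop, congrArg Quiver.Hom.unop hk⟩⟩
    exact ⟨((Functor.whiskeringLeft _ _ _).obj (opOp C)).mapIso (e.app (op W) ≪≫ β)⟩

end ExangulatedStructure

end NExang


/-! ### Assembly of the three statements -/

theorem theorem4p12 (n : ℕ) (hn : 0 < n) {C : Type u} [Category.{v} C] [Preadditive C]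
    [HasZeroObject C] [HasBinaryBiproducts C] (S : NExang.ExangulatedStructure n C)
    (hP : S.HasEnoughProj) (hI : S.HasEnoughInj) :
    -- (1) the two equivalences, given by the defects
    (∃ (F : S.ExangleQuotient ≌ NExang.FPMod S.ModProj)
        (G : S.ExangleQuotient ≌ (NExang.FPMod S.ModInjᵒᵖ)ᵒᵖ),
      Nonempty (S.exangleProj ⋙ F.functor ⋙ NExang.restrict S.proj ≅ S.contraDefect) ∧
      Nonempty (S.exangleProj ⋙ G.functor ⋙ (NExang.restrictOp S.inj).op ≅ S.coDefect)) ∧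
    -- (2) the category `mod-(C/[P])`
    ((∃ a : Abelian (NExang.FPMod S.ModProj), a.toPreadditive = Preadditive.fullSubcategory _) ∧
      EnoughProjectives (NExang.FPMod S.ModProj) ∧
      EnoughInjectives (NExang.FPMod S.ModProj) ∧
      (∀ M : NExang.FPMod S.ModProj, Projective M ↔
        ∃ A : C, Nonempty (Retract M (NExang.FPMod.repr ((NExang.idealProj S.proj).obj A)))) ∧
      (IsIdempotentComplete S.ModProj → ∀ M : NExang.FPMod S.ModProj, Projective M ↔
        ∃ A : C, Nonempty (M ≅ NExang.FPMod.repr ((NExang.idealProj S.proj).obj A))) ∧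
      (Even n →
        (∀ A : C, ∃ M : NExang.FPMod S.ModProj, Injective M ∧
          Nonempty ((NExang.restrict S.proj).obj M ≅ S.E.flip.obj A)) ∧
        (∀ M : NExang.FPMod S.ModProj, Injective M ↔
          ∃ A : C, Nonempty (Retract ((NExang.restrict S.proj).obj M) (S.E.flip.obj A))) ∧
        (IsIdempotentComplete S.ModInj → ∀ M : NExang.FPMod S.ModProj, Injective M ↔
          ∃ A : C, Nonempty ((NExang.restrict S.proj).obj M ≅ S.E.flip.obj A)))) ∧
    -- (3) the category `mod-(C/[I])ᵒᵖ`
    ((∃ a : Abelian (NExang.FPMod S.ModInjᵒᵖ), a.toPreadditive = Preadditive.fullSubcategory _) ∧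
      EnoughProjectives (NExang.FPMod S.ModInjᵒᵖ) ∧
      EnoughInjectives (NExang.FPMod S.ModInjᵒᵖ) ∧
      (∀ M : NExang.FPMod S.ModInjᵒᵖ, Projective M ↔
        ∃ A : C, Nonempty (Retract M (NExang.FPMod.repr (op ((NExang.idealProj S.inj).obj A))))) ∧
      (IsIdempotentComplete S.ModInj → ∀ M : NExang.FPMod S.ModInjᵒᵖ, Projective M ↔
        ∃ A : C, Nonempty (M ≅ NExang.FPMod.repr (op ((NExang.idealProj S.inj).obj A)))) ∧
      (Even n →
        (∀ A : C, ∃ M : NExang.FPMod S.ModInjᵒᵖ, Injective M ∧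
          Nonempty ((NExang.restrictOp S.inj).obj M ≅ S.E.obj (op A))) ∧
        (∀ M : NExang.FPMod S.ModInjᵒᵖ, Injective M ↔
          ∃ A : C, Nonempty (Retract ((NExang.restrictOp S.inj).obj M) (S.E.obj (op A)))) ∧
        (IsIdempotentComplete S.ModProj → ∀ M : NExang.FPMod S.ModInjᵒᵖ, Injective M ↔
          ∃ A : C, Nonempty ((NExang.restrictOp S.inj).obj M ≅ S.E.obj (op A))))) := by
  obtain ⟨F, ⟨f⟩⟩ := NExang.ExangulatedStructure.exists_contraEquivalence hn hP
  obtain ⟨G, ⟨g⟩⟩ := NExang.ExangulatedStructure.exists_coEquivalence hn hI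
  obtain ⟨a⟩ := S.nonempty_contraFunctor_restrict_iso
  obtain ⟨b⟩ := S.nonempty_coFunctor_restrictOp_iso
  obtain ⟨e, he⟩ := NExang.ExangulatedStructure.exists_duality hn hP hI
  have wP := NExang.ExangulatedStructure.weakKernels_modProj hn hP
  have wI := NExang.ExangulatedStructure.weakKernels_modInj_op hn hI
  have := NExang.enoughProjectives (D := S.ModProj)
  have := NExang.enoughProjectives (D := S.ModInjᵒᵖ)
  choose W hW₁ hW₂ using NExang.ExangulatedStructure.exists_injective_presentation hn hI
  choose V hV₁ hV₂ using NExang.ExangulatedStructure.exists_projective_presentation hn hP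
  have hR (M : NExang.FPMod S.ModProj) : Projective M ↔
      ∃ A : C, Nonempty (Retract M (NExang.FPMod.repr ((NExang.idealProj S.proj).obj A))) :=
    (NExang.projective_iff_retract M).trans ⟨fun ⟨A, h⟩ => ⟨A.as, h⟩, fun ⟨A, h⟩ => ⟨_, h⟩⟩
  have hR' (M : NExang.FPMod S.ModInjᵒᵖ) : Projective M ↔
      ∃ A : C, Nonempty (Retract M (NExang.FPMod.repr (op ((NExang.idealProj S.inj).obj A)))) :=
    (NExang.projective_iff_retract M).trans
      ⟨fun ⟨A, h⟩ => ⟨A.unop.as, h⟩, fun ⟨A, h⟩ => ⟨_, h⟩⟩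
  have hS (_ : IsIdempotentComplete S.ModProj) (M : NExang.FPMod S.ModProj) : Projective M ↔
      ∃ A : C, Nonempty (M ≅ NExang.FPMod.repr ((NExang.idealProj S.proj).obj A)) :=
    (NExang.projective_iff_iso M).trans ⟨fun ⟨A, h⟩ => ⟨A.as, h⟩, fun ⟨A, h⟩ => ⟨_, h⟩⟩
  have hS' (h : IsIdempotentComplete S.ModInj) (M : NExang.FPMod S.ModInjᵒᵖ) : Projective M ↔
      ∃ A : C, Nonempty (M ≅ NExang.FPMod.repr (op ((NExang.idealProj S.inj).obj A))) :=
    have := Idempotents.isIdempotentComplete_iff_opposite.2 h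
    (NExang.projective_iff_iso M).trans ⟨fun ⟨A, h⟩ => ⟨A.unop.as, h⟩, fun ⟨A, h⟩ => ⟨_, h⟩⟩
  -- The duality sends the module `𝔼(-,A)`, realized as the defect of `W A`, to the representable at
  -- `A`. `hN'` is the same for the inverse duality, with the exangles `V A` having projective
  -- middle terms.
  have hN (A : C) : Nonempty (e.functor.obj (S.contraFunctor.obj (W A)) ≅
      op (NExang.FPMod.repr (op ((NExang.idealProj S.inj).obj A)))) :=
    ⟨(he (W A)).some ≪≫ (hW₁ A).some.symm.op⟩
  have hN' (A : C) : Nonempty (e.leftOp.symm.functor.obj (S.coFunctor.obj (op (V A))) ≅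
      op (NExang.FPMod.repr ((NExang.idealProj S.proj).obj A))) :=
    ⟨e.leftOp.symm.functor.mapIso (he (V A)).some.unop ≪≫
      e.leftOp.unitIso.symm.app (op (S.contraFunctor.obj (V A))) ≪≫ (hV₁ A).some.symm.op⟩
  have hJ (M : NExang.FPMod S.ModProj) : Injective M ↔
      ∃ A : C, Nonempty (Retract ((NExang.restrict S.proj).obj M) (S.E.flip.obj A)) :=
    (NExang.injective_iff_retract_of_duality e hN hR' M).trans
      (exists_congr fun A => NExang.nonempty_retract_map_iff _ (hW₂ A).some)
  have hJ' (M : NExang.FPMod S.ModInjᵒᵖ) : Injective M ↔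
      ∃ A : C, Nonempty (Retract ((NExang.restrictOp S.inj).obj M) (S.E.obj (op A))) :=
    (NExang.injective_iff_retract_of_duality e.leftOp.symm hN' hR M).trans
      (exists_congr fun A => NExang.nonempty_retract_map_iff _ (hV₂ A).some)
  refine ⟨⟨F, G, ⟨Functor.isoWhiskerRight f (NExang.restrict S.proj) ≪≫ a⟩,
      ⟨Functor.isoWhiskerRight g (NExang.restrictOp S.inj).op ≪≫ b⟩⟩,
    ⟨NExang.exists_abelian wP, inferInstance, NExang.enoughInjectives_of_duality e, hR, hS,
      fun _ => ⟨fun A => ⟨_, (hJ _).2 ⟨A, ⟨Retract.ofIso (hW₂ A).some⟩⟩, hW₂ A⟩, hJ,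
        fun h M => (NExang.injective_iff_iso_of_duality e hN (hS' h) M).trans
          (exists_congr fun A => NExang.nonempty_iso_map_iff _ (hW₂ A).some)⟩⟩,
    ⟨NExang.exists_abelian wI, inferInstance, NExang.enoughInjectives_of_duality e.leftOp.symm,
      hR', hS',
      fun _ => ⟨fun A => ⟨_, (hJ' _).2 ⟨A, ⟨Retract.ofIso (hV₂ A).some⟩⟩, hV₂ A⟩, hJ',
        fun h M => (NExang.injective_iff_iso_of_duality e.leftOp.symm hN' (hS h) M).trans
          (exists_congr fun A => NExang.nonempty_iso_map_iff _ (hV₂ A).some)⟩⟩⟩
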